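/- Let $\mathbb{F}$ be a totally ordered field (the order being compatible with addition and multiplication). A line arrangement is a finite set of lines in $\mathbb{F}^2$, no two parallel and no three concurrent; its intersection points are the pairwise intersections of its lines. A line arrangement collineation isomorphism $\phi : \mathcal{L}_1 \to \mathcal{L}_2$ between two line arrangements with the same number $n$ of lines is a bijection $\phi$ from the intersection points of $\mathcal{L}_1$ to those of $\mathcal{L}_2$ such that any three intersection points on a line of $\mathcal{L}_1$ are mapped to three points on a line of $\mathcal{L}_2$. A map $\phi$ from the intersection points of $\mathcal{L}_1$ to $\mathbb{F}^2$ is an isomorphism of line arrangements if it is the restriction of a piecewise linear automorphism of $\mathbb{F}^2$ which takes the lines of $\mathcal{L}_1$ to the lines of $\mathcal{L}_2$. An inner coordinate of an intersection point $P$ of an arrangement of $n$ lines, on a line $L$ of the arrangement through $P$, is the position $a\in\{1,\dots,n-1\}$ of $P$ among the intersection points on $L$, which is well defined modulo $n$ up to sign. For an arrangement of four lines, the nook point is the unique intersection point neither of whose inner coordinates is $\pm 1 \bmod 4$; the extreme nook point is the intersection point not on a common line with the nook point; the end points are the other intersection points both of whose inner coordinates are $\pm1 \bmod 4$; the remaining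 two intersection points form the pair of central points. Let $\mathcal{L}_1,\mathcal{L}_2$ be line arrangements in $\mathbb{F}^2$ with the same number of lines. (a) Let $\phi : \mathcal{L}_1\to\mathcal{L}_2$ be a line arrangement collineation isomorphism such that, for every four-line subset $\mathcal{Q}\subseteq\mathcal{L}_1$, $\phi$ maps the nook point of $\mathcal{Q}$ to the nook point, and the pair of central points of $\mathcal{Q}$ onto the pair of central points, of the image of $\mathcal{Q}$ (the set of the lines of $\mathcal{L}_2$ that contain the $\phi$-images of all the intersection points of $\mathcal{L}_1$ on some line of $\mathcal{Q}$). Then $\phi$ is an isomorphism of line arrangements. (b) Conversely, every isomorphism of line arrangements $\phi:\mathcal{L}_1\to\mathcal{L}_2$ is a line arrangement collineation isomorphism and, for every four-line subset $\mathcal{Q}\subseteq\mathcal{L}_1$, maps the nook point and the pair of central points of $\mathcal{Q}$ to those of the image of $\mathcal{Q}$. -/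

import Mathlib

open Set

noncomputable section

namespace LineArr

variable {F : Type*} [Field F] [LinearOrder F] [IsStrictOrderedRing F]

/-- A line `a x + b y = c` of the plane `F²`, where `(a, b) ≠ (0, 0)`. -/
def IsLine (L : Set (F × F)) : Prop :=
  ∃ a b c : F, (a ≠ 0 ∨ b ≠ 0) ∧ L = {p | a * p.1 + b * p.2 = c}

/-- A line arrangement: a finite set of lines, no two of which are parallel (two distinct lines
always meet) and no three of which are concurrent. -/
structure IsLineArrangement (A : Set (Set (F × F))) : Prop where
  finite : A.Finite
  isLine : ∀ L ∈ A, IsLine L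
  not_parallel : ∀ L ∈ A, ∀ M ∈ A, L ≠ M → (L ∩ M).Nonempty
  not_concurrent : ∀ L ∈ A, ∀ M ∈ A, ∀ N ∈ A, L ≠ M → L ≠ N → M ≠ N → L ∩ M ∩ N = ∅

/-- The set of intersection points of the lines of `A`. -/
def vertices (A : Set (Set (F × F))) : Set (F × F) :=
  {p | ∃ L ∈ A, ∃ M ∈ A, L ≠ M ∧ p ∈ L ∧ p ∈ M}

/-- `w` is a nonzero direction vector of the line `L`. -/
def IsDirection (L : Set (F × F)) (w : F × F) : Prop :=
  w ≠ 0 ∧ ∀ p ∈ L, p + w ∈ L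

/-- The position (counted from `1`) of the point `p` among the intersection points of `A` on the
line `L`, when `L` is traversed in the direction `w`. -/
def innerCoord (A : Set (Set (F × F))) (L : Set (F × F)) (w p : F × F) : ℕ :=
  {q | q ∈ vertices A ∧ q ∈ L ∧ ∃ t : F, 0 ≤ t ∧ p = q + t • w}.ncard

/-- The inner coordinate of `p` on the line `L` is `± 1` modulo the number of lines of `A`.
(Reversing `L` replaces the inner coordinate by its negative modulo the number of lines.) -/
def IsOuterOn (A : Set (Set (F × F))) (L : Set (F × F)) (p : F × F) : Prop :=
  ∀ w, IsDirection L w →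
    (innerCoord A L w p : ZMod A.ncard) = 1 ∨ (innerCoord A L w p : ZMod A.ncard) = -1

/-- Nook points: the intersection points none of whose inner coordinates is `± 1`.
A four-line arrangement has exactly one. -/
def nookPoints (Q : Set (Set (F × F))) : Set (F × F) :=
  {p | p ∈ vertices Q ∧ ∀ L ∈ Q, p ∈ L → ¬ IsOuterOn Q L p}

/-- Extreme points: the intersection points both of whose inner coordinates are `± 1`. -/
def extremePoints (Q : Set (Set (F × F))) : Set (F × F) :=
  {p | p ∈ vertices Q ∧ ∀ L ∈ Q, p ∈ L → IsOuterOn Q L p}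

/-- The extreme nook point: the intersection point opposite to the nook point, i.e. not on a
common line with it. -/
def extremeNookPoints (Q : Set (Set (F × F))) : Set (F × F) :=
  {p | p ∈ vertices Q ∧ ∃ q ∈ nookPoints Q, ∀ L ∈ Q, q ∈ L → p ∉ L}

/-- The end points: the extreme points other than the extreme nook point. -/
def endPoints (Q : Set (Set (F × F))) : Set (F × F) :=
  extremePoints Q \ extremeNookPoints Q

/-- The central pair: the remaining intersection points. -/
def centralPoints (Q : Set (Set (F × F))) : Set (F × F) :=
  vertices Q \ (nookPoints Q ∪ extremeNookPoints Q ∪ endPoints Q)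

/-- `φ` is a line arrangement collineation isomorphism from `A` to `B`: it restricts to a bijection
of the intersection points, and three intersection points on a line of `A` go to three points on
a line of `B`. Only the values of `φ` at the intersection points of `A` matter. -/
structure IsCollineationIso (A B : Set (Set (F × F))) (φ : F × F → F × F) : Prop where
  bijOn : BijOn φ (vertices A) (vertices B)
  collinear : ∀ p ∈ vertices A, ∀ q ∈ vertices A, ∀ r ∈ vertices A, p ≠ q → p ≠ r → q ≠ r →
    (∃ L ∈ A, p ∈ L ∧ q ∈ L ∧ r ∈ L) → ∃ M ∈ B, φ p ∈ M ∧ φ q ∈ M ∧ φ r ∈ M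

/-- The image under `φ` of a set `Q` of lines of `A`: the lines of `B` that contain the images of
all intersection points of `A` on some line of `Q`. -/
def imageLines (A B : Set (Set (F × F))) (φ : F × F → F × F) (Q : Set (Set (F × F))) :
    Set (Set (F × F)) :=
  {M | M ∈ B ∧ ∃ L ∈ Q, φ '' (vertices A ∩ L) ⊆ M}

/-- `φ` maps the nook point and the pair of central points of every four-line substructure of `A`
to those of its image. -/
def PreservesNookAndCentral (A B : Set (Set (F × F))) (φ : F × F → F × F) : Prop :=
  ∀ Q ⊆ A, Q.ncard = 4 →
    φ '' nookPoints Q = nookPoints (imageLines A B φ Q) ∧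
    φ '' centralPoints Q = centralPoints (imageLines A B φ Q)

/-- A closed convex polyhedron in the plane: a finite intersection of sets `a x + b y ≤ c`. -/
def IsPolyhedron (C : Set (F × F)) : Prop :=
  ∃ H : Finset (F × F × F), C = {p | ∀ h ∈ H, h.1 * p.1 + h.2.1 * p.2 ≤ h.2.2}

/-- Piecewise linear maps of the plane: the plane is a finite union of closed convex polyhedra,
on each of which the map is affine. -/
def IsPiecewiseLinear (f : F × F → F × F) : Prop :=
  ∃ S : Set (Set (F × F)), S.Finite ∧ ⋃₀ S = univ ∧
    ∀ C ∈ S, IsPolyhedron C ∧ ∃ g : (F × F) →ᵃ[F] (F × F), EqOn f g C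

/-- `φ` is an isomorphism from `A` to `B`: on the intersection points it is given by a piecewise
linear automorphism of the plane that takes the lines of `A` to the lines of `B`. -/
def IsArrangementIso (A B : Set (Set (F × F))) (φ : F × F → F × F) : Prop :=
  ∃ f : (F × F) ≃ (F × F), IsPiecewiseLinear f ∧ IsPiecewiseLinear f.symm ∧
    (fun L => f '' L) '' A = B ∧ EqOn φ f (vertices A)

end LineArr

end

/-!
The converse part rests on an intermediate value theorem: a piecewise linear bijection that takes
a line to a line preserves betweenness on it (`IsPiecewiseLinear.sbtw`). Over an arbitrary ordered
field this holds because the sets `{g ≤ 0}` and `{g ≥ 0}` of a piecewise affine function on an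
interval are finite unions of closed intervals, which have extremal points. Nook points and
central pairs are defined by incidence and betweenness.

For the direct part, arrangements of at most two lines are mapped to each other by affine maps.
For at least three lines, counting shows that a collineation isomorphism also maps lines to lines
bijectively (`IsCollineationIso.exists_isIncidenceIso`). In an arrangement of four lines, the
middle one of the three intersection points on a line is the nook point if the line contains it,
and otherwise the central point on the line
(`IsQuadruple.not_isOuterOn_iff_nook_or_central`); this follows from Pasch's axiom and from the
comparison of distances to a fourth line. Hence the assumption implies that betweenness is
preserved on all lines (`IsIncidenceIso.isMid_iff`).

The piecewise linear map is obtained from a construction on fans. The plane is embedded in the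
three-dimensional space `F² × F` at height `1`, and each line is replaced by the plane through the
origin that it spans. With suitably oriented linear forms for these planes, and with the height as
the form of the line at infinity, betweenness determines the signs of all forms at the intersection
points and at the directions of the lines. Every other vector is, without cancellation of signs, a
sum of multiples of such vectors, so that the two arrangements have the same set of sign vectors
(`exists_signVector_eq`). Finally, two pointed fans with the same sign vectors are related by
a piecewise linear bijection (`exists_equiv_of_signVectors`): choose a vector in each cell, write
every vector as a nonnegative combination of the chosen vectors of a chain of faces (this is a
barycentric subdivision), and apply the same coefficients to the vectors of the corresponding
cells. At height `1` this yields the required map of the plane.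
-/

set_option linter.unusedSectionVars false

namespace LineArr

/-! ### Sign vectors and the piecewise linear correspondence of two fans -/

section Fan

variable {F : Type*} [Field F] [LinearOrder F] [IsStrictOrderedRing F]
  {V W ι : Type*} [AddCommGroup V] [Module F V] [AddCommGroup W] [Module F W]

/-- The vector of signs that a family of linear forms takes at `x`. The sets on which it is
constant are the relatively open cells of the fan cut out by the kernels of the forms. -/
def signVector (ℓ : ι → V →ₗ[F] F) (x : V) : ι → SignType :=
  fun i => SignType.sign (ℓ i x)

/-- The face relation between sign vectors: `s` arises from `s'` by replacing some entries
by `0`. -/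
def IsFace (s s' : ι → SignType) : Prop :=
  ∀ i, s i = 0 ∨ s i = s' i

/-- `s` is a face of `s'` that is properly smaller. -/
def IsProperFace (s s' : ι → SignType) : Prop :=
  IsFace s s' ∧ ∃ i, s' i ≠ 0 ∧ s i = 0

lemma IsFace.refl (s : ι → SignType) : IsFace s s := fun _ => Or.inr rfl

lemma IsFace.trans {s s' s'' : ι → SignType} (h : IsFace s s') (h' : IsFace s' s'') :
    IsFace s s'' := by
  intro i
  rcases h i with h | h
  · exact Or.inl h
  · rw [h]; exact h' i

lemma IsFace.trans_isProperFace {s s' s'' : ι → SignType} (h : IsFace s s')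
    (h' : IsProperFace s' s'') : IsProperFace s s'' := by
  obtain ⟨h₁, i, hi, hi'⟩ := h'
  refine ⟨h.trans h₁, i, hi, ?_⟩
  rcases h i with h | h
  · exact h
  · rw [h, hi']

lemma IsFace.isProperFace_of_ne {s s' : ι → SignType} (h : IsFace s s') (hne : s ≠ s') :
    IsProperFace s s' := by
  obtain ⟨i, hi⟩ := Function.ne_iff.1 hne
  have h0 := (h i).resolve_right hi
  exact ⟨h, i, fun h' => hi (h0.trans h'.symm), h0⟩

/-- The number of nonzero entries of a sign vector. -/
noncomputable def supportCard [Finite ι] (s : ι → SignType) : ℕ := {i | s i ≠ 0}.ncard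

lemma IsProperFace.supportCard_lt [Finite ι] {s s' : ι → SignType} (h : IsProperFace s s') :
    supportCard s < supportCard s' := by
  obtain ⟨h₁, i, hi, hi'⟩ := h
  refine ncard_lt_ncard ⟨fun j hj => ?_, fun h => h hi hi'⟩ (toFinite _)
  rcases h₁ j with h | h
  · exact absurd h hj
  · simpa [← h] using hj

lemma sign_smul_add {s : SignType} {t a b : F} (ht : 0 < t) (ha : SignType.sign a = s)
    (hb : SignType.sign b = 0 ∨ SignType.sign b = s) : SignType.sign (t * a + b) = s := by
  subst ha
  rcases lt_trichotomy a 0 with h | h | h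
  · rw [sign_neg h] at hb ⊢
    have hb' : b ≤ 0 := by
      rcases hb with hb | hb
      · exact (sign_eq_zero_iff.1 hb).le
      · exact (sign_eq_neg_one_iff.1 hb).le
    exact sign_neg (by nlinarith [mul_neg_of_pos_of_neg ht h])
  · subst h
    simpa using hb
  · rw [sign_pos h] at hb ⊢
    have hb' : 0 ≤ b := by
      rcases hb with hb | hb
      · exact (sign_eq_zero_iff.1 hb).ge
      · exact (sign_eq_one_iff.1 hb).le
    exact sign_pos (by nlinarith [mul_pos ht h])

lemma signVector_smul_add {ℓ : ι → V →ₗ[F] F} {s : ι → SignType} {t : F} {x y : V} (ht : 0 < t)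
    (hx : signVector ℓ x = s) (hy : IsFace (signVector ℓ y) s) :
    signVector ℓ (t • x + y) = s := by
  funext i
  simp only [signVector, map_add, map_smul, smul_eq_mul]
  exact sign_smul_add ht (congrFun hx i) (hy i)

/-- Subtracting from `x` the largest possible multiple of a vector `p` of the same cell leads to
a proper face of that cell. -/
lemma exists_peel [Finite ι] {ℓ : ι → V →ₗ[F] F} {x p : V}
    (hp : signVector ℓ p = signVector ℓ x) (hx : signVector ℓ x ≠ 0) :
    ∃ t : F, 0 < t ∧ ∃ y : V, x = t • p + y ∧
      IsProperFace (signVector ℓ y) (signVector ℓ x) := by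
  have hne : {i | ℓ i x ≠ 0}.Nonempty := by
    obtain ⟨i, hi⟩ := Function.ne_iff.1 hx
    exact ⟨i, fun h => hi (by simp [signVector, h])⟩
  obtain ⟨i, hi, hmin⟩ := exists_min_image _ (fun i => ℓ i x / ℓ i p) (toFinite _) hne
  have hs : ∀ j, SignType.sign (ℓ j p) = SignType.sign (ℓ j x) := congrFun hp
  have hpos : ∀ j, ℓ j x ≠ 0 → 0 < ℓ j x / ℓ j p := by
    intro j hj
    rcases lt_or_gt_of_ne hj with h | h
    · have := hs j
      rw [sign_neg h, sign_eq_neg_one_iff] at this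
      exact div_pos_of_neg_of_neg h this
    · have := hs j
      rw [sign_pos h, sign_eq_one_iff] at this
      exact div_pos h this
  refine ⟨ℓ i x / ℓ i p, hpos i hi, x - (ℓ i x / ℓ i p) • p, by abel, fun j => ?_, i, ?_, ?_⟩
  · change SignType.sign (ℓ j (x - _)) = 0 ∨ SignType.sign (ℓ j (x - _)) = SignType.sign (ℓ j x)
    simp only [map_sub, map_smul, smul_eq_mul]
    by_cases hj : ℓ j x = 0
    · left
      have := hs j
      rw [hj, sign_zero, sign_eq_zero_iff] at this
      simp [hj, this]
    · have h1 := hmin j hj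
      have h0 := hpos j hj
      have hpj : ℓ j p ≠ 0 := fun h => by simp [h] at h0
      have key : ℓ j x - ℓ i x / ℓ i p * ℓ j p =
          (ℓ j x / ℓ j p - ℓ i x / ℓ i p) * ℓ j p := by
        field_simp
      rw [key, sign_mul, hs j]
      rcases h1.eq_or_lt with h | h
      · left; simp [h]
      · right; rw [sign_pos (sub_pos.2 h), one_mul]
  · simpa [signVector] using hi
  · have : ℓ i p ≠ 0 := fun h => by simpa [h] using hpos i hi
    simp [signVector, div_mul_cancel₀ _ this]

/-- The correspondence between two fans with the same set `X` of sign vectors that takes, for a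
chain of faces, the nonnegative combinations of the chosen vectors `p s` of the cells of the chain
to the same combinations of the vectors `q s`. -/
inductive FanRel (ℓ : ι → V →ₗ[F] F) (X : Set (ι → SignType)) (p : (ι → SignType) → V)
    (q : (ι → SignType) → W) : V → W → Prop
  | zero : FanRel ℓ X p q 0 0
  | step (s : ι → SignType) (t : F) (y : V) (y' : W) : s ∈ X → 0 < t →
      IsProperFace (signVector ℓ y) s → FanRel ℓ X p q y y' →
      FanRel ℓ X p q (t • p s + y) (t • q s + y')

variable {ℓ : ι → V →ₗ[F] F} {m : ι → W →ₗ[F] F} {X : Set (ι → SignType)}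
  {p : (ι → SignType) → V} {q : (ι → SignType) → W}

lemma FanRel.signVector_eq (hp : ∀ s ∈ X, signVector ℓ (p s) = s)
    (hq : ∀ s ∈ X, signVector m (q s) = s) {x : V} {x' : W} (h : FanRel ℓ X p q x x') :
    signVector m x' = signVector ℓ x := by
  induction h with
  | zero => funext i; simp [signVector]
  | step s t y y' hs ht hy _ ih =>
    rw [signVector_smul_add ht (hp s hs) hy.1, signVector_smul_add ht (hq s hs) (ih ▸ hy.1)]

lemma FanRel.symm (hp : ∀ s ∈ X, signVector ℓ (p s) = s)
    (hq : ∀ s ∈ X, signVector m (q s) = s) {x : V} {x' : W} (h : FanRel ℓ X p q x x') :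
    FanRel m X q p x' x := by
  induction h with
  | zero => exact .zero
  | step s t y y' hs ht hy hr ih =>
    exact .step s t y' y hs ht (hr.signVector_eq hp hq ▸ hy) ih

lemma FanRel.apply_eq {o : ι} (ho : ∀ s ∈ X, m o (q s) = ℓ o (p s)) {x : V} {x' : W}
    (h : FanRel ℓ X p q x x') : m o x' = ℓ o x := by
  induction h with
  | zero => simp
  | step s t y y' hs _ _ _ ih => simp [ho s hs, ih]

lemma FanRel.exists_right [Finite ι] (hℓ : ∀ x, (∀ i, ℓ i x = 0) → x = 0)
    (hX : ∀ x, signVector ℓ x ∈ X) (hp : ∀ s ∈ X, signVector ℓ (p s) = s) (x : V) :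
    ∃ x', FanRel ℓ X p q x x' := by
  induction hn : supportCard (signVector ℓ x) using Nat.strong_induction_on generalizing x with
  | _ n ih =>
    by_cases h0 : signVector ℓ x = 0
    · obtain rfl := hℓ x fun i => sign_eq_zero_iff.1 (congrFun h0 i)
      exact ⟨0, .zero⟩
    · obtain ⟨t, ht, y, hxy, hy⟩ := exists_peel (hp _ (hX x)) h0
      obtain ⟨y', hy'⟩ := ih _ (hn ▸ hy.supportCard_lt) y rfl
      refine ⟨t • q (signVector ℓ x) + y', ?_⟩
      have := FanRel.step (q := q) _ t y y' (hX x) ht hy hy'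
      rwa [← hxy] at this

lemma FanRel.inv {x : V} {x' : W} (h : FanRel ℓ X p q x x') :
    (x = 0 ∧ x' = 0) ∨ ∃ s, ∃ t : F, ∃ y y', s ∈ X ∧ 0 < t ∧ IsProperFace (signVector ℓ y) s ∧
      FanRel ℓ X p q y y' ∧ x = t • p s + y ∧ x' = t • q s + y' := by
  cases h with
  | zero => exact Or.inl ⟨rfl, rfl⟩
  | step s t y y' hs ht hy hr => exact Or.inr ⟨s, t, y, y', hs, ht, hy, hr, rfl, rfl⟩

/-- The coefficient of the vector `v` of the cell `s` that is split off to reach a proper face of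
`s` is unique; this is one of the two inequalities. -/
lemma le_of_smul_add_eq {s : ι → SignType} {v y y₂ : V} {t t₂ : F}
    (hv : signVector ℓ v = s) (hy : IsProperFace (signVector ℓ y) s)
    (hy₂ : IsProperFace (signVector ℓ y₂) s) (h : t • v + y = t₂ • v + y₂) : t₂ ≤ t := by
  by_contra! hlt
  have hy' : y = (t₂ - t) • v + y₂ := by
    rw [sub_smul, sub_add_eq_add_sub, ← h]; abel
  obtain ⟨-, i, hi, hi'⟩ := hy
  rw [hy', signVector_smul_add (sub_pos.2 hlt) hv hy₂.1] at hi'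
  exact hi hi'

lemma FanRel.unique (hp : ∀ s ∈ X, signVector ℓ (p s) = s) {x : V} {x' x'' : W}
    (h : FanRel ℓ X p q x x') (h' : FanRel ℓ X p q x x'') : x' = x'' := by
  induction h generalizing x'' with
  | zero =>
    rcases h'.inv with ⟨-, h⟩ | ⟨s, t, y, y', hs, ht, hy, -, h0, -⟩
    · exact h.symm
    · have := signVector_smul_add ht (hp s hs) hy.1
      obtain ⟨-, i, hi, -⟩ := hy
      rw [← h0] at this
      exact absurd (congrFun this i).symm (by simpa [signVector] using hi)
  | step s t y y' hs ht hy hr ih =>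
    have hs1 := signVector_smul_add ht (hp s hs) hy.1
    rcases h'.inv with ⟨h0, -⟩ | ⟨s₂, t₂, y₂, y₂', hs₂, ht₂, hy₂, hr₂, hx, rfl⟩
    · obtain ⟨-, i, hi, -⟩ := hy
      rw [h0] at hs1
      exact absurd (congrFun hs1 i).symm (by simpa [signVector] using hi)
    · obtain rfl : s₂ = s := by
        rw [← hs1, hx, signVector_smul_add ht₂ (hp s₂ hs₂) hy₂.1]
      obtain rfl : t = t₂ := le_antisymm (le_of_smul_add_eq (hp _ hs) hy₂ hy hx.symm)
        (le_of_smul_add_eq (hp _ hs) hy hy₂ hx)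
      obtain rfl : y = y₂ := add_left_cancel hx
      rw [ih hr₂]

/-- A polyhedral cone: a finite intersection of sets `h x ≤ 0` with linear `h`. -/
def IsPolyhedralCone (C : Set V) : Prop :=
  ∃ H : Set (V →ₗ[F] F), H.Finite ∧ C = {x | ∀ h ∈ H, h x ≤ 0}

lemma IsPolyhedralCone.comap {C : Set W} (hC : IsPolyhedralCone (F := F) C) (g : V →ₗ[F] W) :
    IsPolyhedralCone (F := F) (g ⁻¹' C) := by
  obtain ⟨H, hH, rfl⟩ := hC
  refine ⟨(fun h => h.comp g) '' H, hH.image _, ?_⟩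
  ext x
  simp

lemma IsPolyhedralCone.inter_halfspace {C : Set V} (hC : IsPolyhedralCone (F := F) C)
    (h : V →ₗ[F] F) : IsPolyhedralCone (F := F) ({x | 0 ≤ h x} ∩ C) := by
  obtain ⟨H, hH, rfl⟩ := hC
  refine ⟨insert (-h) H, hH.insert _, ?_⟩
  ext x
  simp

/-- The set `U` is covered by finitely many polyhedral cones inside the closed cell of the sign
vector `s`, on each of which `FanRel` is the graph of a linear map. -/
def HasLinearPieces (ℓ : ι → V →ₗ[F] F) (X : Set (ι → SignType)) (p : (ι → SignType) → V)
    (q : (ι → SignType) → W) (s : ι → SignType) (U : Set V) : Prop :=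
  ∃ 𝒞 : Set (Set V), 𝒞.Finite ∧ U ⊆ ⋃₀ 𝒞 ∧ ∀ C ∈ 𝒞, IsPolyhedralCone (F := F) C ∧
    (∀ x ∈ C, IsFace (signVector ℓ x) s) ∧ ∃ g : V →ₗ[F] W, ∀ x ∈ C, FanRel ℓ X p q x (g x)

lemma HasLinearPieces.iUnion {κ : Type*} [Finite κ] {s : ι → SignType} {U : κ → Set V}
    (h : ∀ k, HasLinearPieces ℓ X p q s (U k)) : HasLinearPieces ℓ X p q s (⋃ k, U k) := by
  choose 𝒞 h1 h2 h3 using h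
  refine ⟨⋃ k, 𝒞 k, finite_iUnion h1, ?_, ?_⟩
  · refine iUnion_subset fun k => (h2 k).trans (sUnion_subset_sUnion (subset_iUnion _ k))
  · intro C hC
    obtain ⟨k, hk⟩ := mem_iUnion.1 hC
    exact h3 k C hk

lemma HasLinearPieces.union {s : ι → SignType} {U U' : Set V}
    (h : HasLinearPieces ℓ X p q s U) (h' : HasLinearPieces ℓ X p q s U') :
    HasLinearPieces ℓ X p q s (U ∪ U') := by
  rw [union_eq_iUnion]
  exact HasLinearPieces.iUnion fun b => by cases b <;> simpa

lemma HasLinearPieces.subset {s : ι → SignType} {U U' : Set V}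
    (h : HasLinearPieces ℓ X p q s U) (h' : U' ⊆ U) : HasLinearPieces ℓ X p q s U' := by
  obtain ⟨𝒞, h1, h2, h3⟩ := h
  exact ⟨𝒞, h1, h'.trans h2, h3⟩

lemma HasLinearPieces.mono {s s' : ι → SignType} {U : Set V}
    (h : HasLinearPieces ℓ X p q s U) (h' : IsFace s s') : HasLinearPieces ℓ X p q s' U := by
  obtain ⟨𝒞, h1, h2, h3⟩ := h
  exact ⟨𝒞, h1, h2, fun C hC => ⟨(h3 C hC).1, fun x hx => ((h3 C hC).2.1 x hx).trans h',
    (h3 C hC).2.2⟩⟩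

/-- The projection along `v` to the kernel of the form `h`, when `h v ≠ 0`. -/
noncomputable def kerProj (h : V →ₗ[F] F) (v : V) : V →ₗ[F] V :=
  LinearMap.id - ((h v)⁻¹ • h).smulRight v

lemma kerProj_apply (h : V →ₗ[F] F) (v x : V) :
    kerProj h v x = x - ((h v)⁻¹ * h x) • v := by
  simp [kerProj]

/-- If the projection of `x` along `p s` lies in a piece of a proper face of `s`, then `x` lies
in a piece of `s`: the cone over the former with apex direction `p s`. -/
lemma HasLinearPieces.cone {s s' : ι → SignType} (hp : ∀ s ∈ X, signVector ℓ (p s) = s)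
    (hs : s ∈ X) (hs' : IsProperFace s' s) {U : Set V} (h : HasLinearPieces ℓ X p q s' U) (i : ι) :
    HasLinearPieces ℓ X p q s
      {x | 0 ≤ (ℓ i (p s))⁻¹ * ℓ i x ∧ kerProj (ℓ i) (p s) x ∈ U} := by
  obtain ⟨𝒞, h1, h2, h3⟩ := h
  refine ⟨(fun C => {x | 0 ≤ ((ℓ i (p s))⁻¹ • ℓ i) x} ∩ (kerProj (ℓ i) (p s)) ⁻¹' C) '' 𝒞,
    h1.image _, ?_, ?_⟩
  · rintro x ⟨hx, hxU⟩
    obtain ⟨C, hC, hxC⟩ := h2 hxU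
    exact ⟨_, mem_image_of_mem _ hC, hx, hxC⟩
  · rintro _ ⟨C, hC, rfl⟩
    obtain ⟨hCp, hCf, g, hg⟩ := h3 C hC
    have hx : ∀ x, x = ((ℓ i (p s))⁻¹ * ℓ i x) • p s + kerProj (ℓ i) (p s) x := by
      intro x; rw [kerProj_apply]; abel
    refine ⟨(hCp.comap _).inter_halfspace _, ?_,
      ((ℓ i (p s))⁻¹ • ℓ i).smulRight (q s) + g.comp (kerProj (ℓ i) (p s)), ?_⟩
    · rintro x ⟨h0, hxC⟩
      have hf := (hCf _ hxC).trans hs'.1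
      rcases (show (0 : F) ≤ (ℓ i (p s))⁻¹ * ℓ i x from h0).eq_or_lt with h | h
      · have := hx x
        rw [← h, zero_smul, zero_add] at this
        rwa [this]
      · rw [hx x, signVector_smul_add h (hp s hs) hf]
        exact .refl s
    · rintro x ⟨h0, hxC⟩
      have hgx : (((ℓ i (p s))⁻¹ • ℓ i).smulRight (q s) + g.comp (kerProj (ℓ i) (p s))) x =
          ((ℓ i (p s))⁻¹ * ℓ i x) • q s + g (kerProj (ℓ i) (p s) x) := by simp
      rw [hgx]
      rcases (show (0 : F) ≤ (ℓ i (p s))⁻¹ * ℓ i x from h0).eq_or_lt with h | h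
      · have hx' := hx x
        rw [← h, zero_smul, zero_add] at hx' ⊢
        have := hg _ hxC
        rwa [← hx'] at this ⊢
      · have := FanRel.step (p := p) (q := q) s _ _ _ hs h
          ((hCf _ hxC).trans_isProperFace hs') (hg _ hxC)
        rwa [← hx x] at this

/-- By induction on the dimension, every closed cell is a finite union of polyhedral cones on
which `FanRel` is linear: those of its proper faces, and the cones over these whose additional ray
is spanned by the vector `p s` inside the cell. -/
lemma hasLinearPieces_closedCell [Finite ι] (hℓ : ∀ x, (∀ i, ℓ i x = 0) → x = 0)
    (hp : ∀ s ∈ X, signVector ℓ (p s) = s) (hX : ∀ x, signVector ℓ x ∈ X) (s : ι → SignType) :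
    HasLinearPieces ℓ X p q s {x | IsFace (signVector ℓ x) s} := by
  induction hn : supportCard s using Nat.strong_induction_on generalizing s with
  | _ n ih =>
    by_cases h0 : s = 0
    · subst h0
      refine ⟨{{0}}, finite_singleton _, ?_, ?_⟩
      · intro x hx
        have : x = 0 := hℓ x fun i => by
          have := hx i
          simpa [signVector] using this
        simp [this]
      · rintro _ rfl
        refine ⟨⟨range ℓ ∪ range (-ℓ), (finite_range _).union (finite_range _), ?_⟩, ?_, 0, ?_⟩
        · ext x
          constructor
          · rintro rfl; simp
          · intro h
            refine hℓ x fun i => le_antisymm (h _ (Or.inl ⟨i, rfl⟩)) ?_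
            simpa using h _ (Or.inr ⟨i, rfl⟩)
        · rintro _ rfl i; simp [signVector]
        · rintro _ rfl; simpa using FanRel.zero
    -- the lower-dimensional faces, and the cones over them
    have hlow : ∀ s' : {s' // IsProperFace s' s},
        HasLinearPieces ℓ X p q s' {x | IsFace (signVector ℓ x) s'} := fun s' =>
      ih _ (hn ▸ s'.2.supportCard_lt) _ rfl
    have h1 := HasLinearPieces.iUnion fun s' => (hlow s').mono s'.2.1
    by_cases hs : s ∈ X
    · have h2 := HasLinearPieces.iUnion
        fun a : {s' // IsProperFace s' s} × ι => (hlow a.1).cone hp hs a.1.2 a.2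
      refine (h1.union h2).subset fun x hx => ?_
      by_cases hxs : signVector ℓ x = s
      · right
        obtain ⟨t, ht, y, hxy, hy⟩ := exists_peel (p := p s) (x := x) (by rw [hp s hs, hxs])
          (by rwa [hxs])
        rw [hxs] at hy
        obtain ⟨i, hi, hi'⟩ := hy.2
        have hpi : ℓ i (p s) ≠ 0 := by
          intro h
          apply hi
          rw [← congrFun (hp s hs) i]
          simp [signVector, h]
        have hyi : ℓ i y = 0 := sign_eq_zero_iff.1 hi'
        have ht' : (ℓ i (p s))⁻¹ * ℓ i x = t := by
          rw [hxy]; simp [hyi]; field_simp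
        refine mem_iUnion.2 ⟨(⟨_, hy⟩, i), ?_, ?_⟩
        · rw [ht']; exact ht.le
        · have : kerProj (ℓ i) (p s) x = y := by
            rw [kerProj_apply, ht', hxy]; abel
          rw [this]
          exact IsFace.refl _
      · left
        exact mem_iUnion.2 ⟨⟨_, IsFace.isProperFace_of_ne hx hxs⟩, IsFace.refl _⟩
    · refine h1.subset fun x hx => ?_
      exact mem_iUnion.2 ⟨⟨_, IsFace.isProperFace_of_ne hx
        fun h => hs (h ▸ hX x)⟩, IsFace.refl _⟩

/-- Two pointed fans of linear forms with the same sign vectors are related by a bijection that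
preserves signs and the values of one of the forms, and is linear on each of finitely many
polyhedral cones that cover the space, as is its inverse. -/
theorem exists_equiv_of_signVectors [Finite ι] (hℓ : ∀ x, (∀ i, ℓ i x = 0) → x = 0)
    (hm : ∀ x, (∀ i, m i x = 0) → x = 0)
    (h : ∀ x, ∃ x', signVector m x' = signVector ℓ x)
    (h' : ∀ x', ∃ x, signVector ℓ x = signVector m x') (o : ι) :
    ∃ f : V ≃ W, (∀ x, signVector m (f x) = signVector ℓ x) ∧ (∀ x, m o (f x) = ℓ o x) ∧
      (∃ 𝒞 : Set (Set V), 𝒞.Finite ∧ ⋃₀ 𝒞 = univ ∧ ∀ C ∈ 𝒞, IsPolyhedralCone (F := F) C ∧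
        ∃ g : V →ₗ[F] W, EqOn f g C) ∧
      (∃ 𝒞 : Set (Set W), 𝒞.Finite ∧ ⋃₀ 𝒞 = univ ∧ ∀ C ∈ 𝒞, IsPolyhedralCone (F := F) C ∧
        ∃ g : W →ₗ[F] V, EqOn f.symm g C) := by
  have key : ∀ s ∈ range (signVector ℓ), ∃ v : V × W, signVector ℓ v.1 = s ∧
      signVector m v.2 = s ∧ m o v.2 = ℓ o v.1 := by
    rintro _ ⟨x, rfl⟩
    obtain ⟨x', hx'⟩ := h x
    have ho : SignType.sign (m o x') = SignType.sign (ℓ o x) := congrFun hx' o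
    by_cases h0 : ℓ o x = 0
    · rw [h0, sign_zero, sign_eq_zero_iff] at ho
      exact ⟨(x, x'), rfl, hx', by simp [h0, ho]⟩
    · have hpos : 0 < ℓ o x / m o x' := by
        rcases lt_or_gt_of_ne h0 with h | h
        · rw [sign_neg h, sign_eq_neg_one_iff] at ho
          exact div_pos_of_neg_of_neg h ho
        · rw [sign_pos h, sign_eq_one_iff] at ho
          exact div_pos h ho
      refine ⟨(x, (ℓ o x / m o x') • x'), rfl, ?_, ?_⟩
      · have := signVector_smul_add (y := 0) hpos hx' fun i => Or.inl (by simp [signVector])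
        simpa using this
      · have : m o x' ≠ 0 := fun h => by simp [h] at hpos
        simp [div_mul_cancel₀ _ this]
  choose! v hvp hvq hvo using key
  have hX : ∀ x, signVector ℓ x ∈ range (signVector ℓ) := fun x => ⟨x, rfl⟩
  have hX' : ∀ x, signVector m x ∈ range (signVector ℓ) := h'
  choose f hf using FanRel.exists_right (q := fun s => (v s).2) hℓ hX hvp
  choose g hg using FanRel.exists_right (q := fun s => (v s).1) hm hX' hvq
  have hgf : ∀ x, g (f x) = x := fun x =>
    (hg (f x)).unique hvq ((hf x).symm hvp hvq)
  have hfg : ∀ x, f (g x) = x := fun x =>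
    (hf (g x)).unique hvp ((hg x).symm hvq hvp)
  refine ⟨⟨f, g, hgf, hfg⟩, fun x => (hf x).signVector_eq hvp hvq,
    fun x => (hf x).apply_eq hvo, ?_, ?_⟩
  · have := fun s => hasLinearPieces_closedCell (q := fun s => (v s).2) hℓ hvp hX s
    choose 𝒞 h1 h2 h3 using this
    refine ⟨⋃ s, 𝒞 s, finite_iUnion h1, eq_univ_of_forall fun x => ?_, fun C hC => ?_⟩
    · obtain ⟨C, hC, hxC⟩ := h2 (signVector ℓ x) (IsFace.refl _)
      exact ⟨C, mem_iUnion.2 ⟨_, hC⟩, hxC⟩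
    · obtain ⟨s, hs⟩ := mem_iUnion.1 hC
      obtain ⟨h, -, G, hG⟩ := h3 s C hs
      exact ⟨h, G, fun x hx => (hf x).unique hvp (hG x hx)⟩
  · have := fun s => hasLinearPieces_closedCell (q := fun s => (v s).1) hm hvq hX' s
    choose 𝒞 h1 h2 h3 using this
    refine ⟨⋃ s, 𝒞 s, finite_iUnion h1, eq_univ_of_forall fun x => ?_, fun C hC => ?_⟩
    · obtain ⟨C, hC, hxC⟩ := h2 (signVector m x) (IsFace.refl _)
      exact ⟨C, mem_iUnion.2 ⟨_, hC⟩, hxC⟩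
    · obtain ⟨s, hs⟩ := mem_iUnion.1 hC
      obtain ⟨h, -, G, hG⟩ := h3 s C hs
      exact ⟨h, G, fun x hx => (hg x).unique hvq (hG x hx)⟩

end Fan

/-! ### Sign vectors are determined by those of the extremal rays -/

section Elementary

variable {F : Type*} [Field F] [LinearOrder F] [IsStrictOrderedRing F]
  {V W ι : Type*} [AddCommGroup V] [Module F V] [AddCommGroup W] [Module F W]
  {ℓ : ι → V →ₗ[F] F} {m : ι → W →ₗ[F] F}

lemma sign_add_eq_of_faces {s : SignType} {a b : F}
    (ha : SignType.sign a = 0 ∨ SignType.sign a = s)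
    (hb : SignType.sign b = 0 ∨ SignType.sign b = s)
    (hab : s ≠ 0 → SignType.sign a ≠ 0 ∨ SignType.sign b ≠ 0) : SignType.sign (a + b) = s := by
  by_cases hs : s = 0
  · subst hs
    simp only [or_self, sign_eq_zero_iff] at ha hb
    simp [ha, hb]
  rcases hab hs with h | h
  · simpa using sign_smul_add (t := 1) one_pos (ha.resolve_left h) hb
  · rw [add_comm]
    simpa using sign_smul_add (t := 1) one_pos (hb.resolve_left h) ha

/-- A vector that does not span an extremal ray of the closed cell containing it is, up to a
positive factor, the sum of two vectors of proper faces of that cell. -/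
lemma exists_add_of_notMem_span [Finite ι] (hℓ : ∀ x, (∀ i, ℓ i x = 0) → x = 0) {x w : V}
    (hx : x ≠ 0) (hw : ∀ i, ℓ i x = 0 → ℓ i w = 0) (hwx : w ∉ Submodule.span F {x}) :
    ∃ y z : V, ∃ c : F, 0 < c ∧ y + z = c • x ∧
      IsProperFace (signVector ℓ y) (signVector ℓ x) ∧
      IsProperFace (signVector ℓ z) (signVector ℓ x) := by
  have hne : {i | ℓ i x ≠ 0}.Nonempty := by
    by_contra h
    refine hx (hℓ x fun i => ?_)
    by_contra hi
    exact h ⟨i, hi⟩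
  -- `y = w - a x` and `z = b x - w`, where `a` and `b` are the extreme ratios of `w` to `x`
  obtain ⟨j, hj, hmin⟩ := exists_min_image _ (fun i => ℓ i w / ℓ i x) (toFinite _) hne
  obtain ⟨k, hk, hmax⟩ := exists_max_image _ (fun i => ℓ i w / ℓ i x) (toFinite _) hne
  set a := ℓ j w / ℓ j x with ha
  set b := ℓ k w / ℓ k x with hb
  have hab : a < b := by
    refine lt_of_le_of_ne (hmax j hj) fun hab => hwx ?_
    have : w - a • x = 0 := hℓ _ fun i => by
      by_cases hi : ℓ i x = 0
      · simp [hi, hw i hi]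
      · have h1 := hmin i hi
        have h2 := hmax i hi
        have : ℓ i w / ℓ i x = a := le_antisymm (hab ▸ h2) h1
        rw [div_eq_iff hi] at this
        simp [this]
    rw [sub_eq_zero.1 this]
    exact Submodule.smul_mem _ _ (Submodule.mem_span_singleton_self x)
  refine ⟨w - a • x, b • x - w, b - a, sub_pos.2 hab, by rw [sub_smul]; abel,
    ⟨fun i => ?_, j, ?_, ?_⟩, ⟨fun i => ?_, k, ?_, ?_⟩⟩
  · change SignType.sign (ℓ i (w - _)) = 0 ∨ SignType.sign (ℓ i (w - _)) = SignType.sign (ℓ i x)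
    by_cases hi : ℓ i x = 0
    · simp [hi, hw i hi]
    · have h1 := hmin i hi
      have key : ℓ i (w - a • x) = (ℓ i w / ℓ i x - a) * ℓ i x := by
        simp only [map_sub, map_smul, smul_eq_mul]; field_simp
      rw [key, sign_mul]
      rcases h1.eq_or_lt with h | h
      · left; simp [h]
      · right; rw [sign_pos (sub_pos.2 h), one_mul]
  · simpa [signVector] using hj
  · have hj' : ℓ j x ≠ 0 := hj
    simp [signVector, ha, div_mul_cancel₀ _ hj']
  · change SignType.sign (ℓ i (_ - w)) = 0 ∨ SignType.sign (ℓ i (_ - w)) = SignType.sign (ℓ i x)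
    by_cases hi : ℓ i x = 0
    · simp [hi, hw i hi]
    · have h1 := hmax i hi
      have key : ℓ i (b • x - w) = (b - ℓ i w / ℓ i x) * ℓ i x := by
        simp only [map_sub, map_smul, smul_eq_mul]; field_simp
      rw [key, sign_mul]
      rcases h1.eq_or_lt with h | h
      · left; simp [h]
      · right; rw [sign_pos (sub_pos.2 h), one_mul]
  · simpa [signVector] using hk
  · have hk' : ℓ k x ≠ 0 := hk
    simp [signVector, hb, div_mul_cancel₀ _ hk']

/-- In dimension three, if the sign vectors of all vectors on two of the planes are sign vectors
of a second family of forms, then all sign vectors are. -/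
theorem exists_signVector_eq [Finite ι] [Nonempty ι] (hV : Module.finrank F V = 3)
    (hℓ : ∀ x, (∀ i, ℓ i x = 0) → x = 0)
    (h : ∀ x i j, i ≠ j → ℓ i x = 0 → ℓ j x = 0 → ∃ x', signVector m x' = signVector ℓ x) (x : V) :
    ∃ x', signVector m x' = signVector ℓ x := by
  induction hn : supportCard (signVector ℓ x) using Nat.strong_induction_on generalizing x with
  | _ n ih =>
    by_cases hx : x = 0
    · subst hx; exact ⟨0, by funext i; simp [signVector]⟩
    by_cases h2 : ∃ i j, i ≠ j ∧ ℓ i x = 0 ∧ ℓ j x = 0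
    · obtain ⟨i, j, hij, hi, hj⟩ := h2
      exact h x i j hij hi hj
    push Not at h2
    obtain ⟨i₀, hi₀⟩ : ∃ i₀, ∀ i, ℓ i x = 0 → i = i₀ := by
      by_cases he : ∃ i, ℓ i x = 0
      · obtain ⟨i₀, h₀⟩ := he
        exact ⟨i₀, fun i hi => by_contra fun hne => h2 i i₀ hne hi h₀⟩
      · push Not at he
        exact ⟨Classical.arbitrary ι, fun i hi => absurd hi (he i)⟩
    have : FiniteDimensional F V := FiniteDimensional.of_finrank_pos (by omega)
    obtain ⟨w, hw, hwx⟩ : ∃ w, ℓ i₀ w = 0 ∧ w ∉ Submodule.span F {x} := by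
      by_contra! hcon
      have hle : LinearMap.ker (ℓ i₀) ≤ Submodule.span F {x} := fun w hw => hcon w hw
      have h3 := Submodule.finrank_mono hle
      have h4 := (ℓ i₀).finrank_range_add_finrank_ker
      have h5 := finrank_span_singleton (K := F) hx
      have h6 := Submodule.finrank_le (LinearMap.range (ℓ i₀))
      rw [Module.finrank_self] at h6
      omega
    obtain ⟨y, z, c, hc, hyz, hy, hz⟩ := exists_add_of_notMem_span hℓ hx
      (fun i hi => by rw [hi₀ i hi]; exact hw) hwx
    obtain ⟨y', hy'⟩ := ih _ (hn ▸ hy.supportCard_lt) y rfl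
    obtain ⟨z', hz'⟩ := ih _ (hn ▸ hz.supportCard_lt) z rfl
    refine ⟨y' + z', funext fun i => ?_⟩
    change SignType.sign (m i (y' + z')) = _
    rw [map_add]
    have e1 : SignType.sign (m i y') = SignType.sign (ℓ i y) := congrFun hy' i
    have e2 : SignType.sign (m i z') = SignType.sign (ℓ i z) := congrFun hz' i
    refine sign_add_eq_of_faces (e1 ▸ hy.1 i) (e2 ▸ hz.1 i) fun hi => ?_
    rw [e1, e2]
    by_contra! hcon
    have h7 : ℓ i (y + z) = 0 := by
      rw [map_add, sign_eq_zero_iff.1 hcon.1, sign_eq_zero_iff.1 hcon.2, add_zero]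
    rw [hyz, map_smul, smul_eq_mul] at h7
    apply hi
    simpa [signVector, hc.ne'] using h7

end Elementary

/-! ### Incidences in a line arrangement -/

section Incidence

variable {F : Type*} [Field F] [LinearOrder F] [IsStrictOrderedRing F]
  {A B Q : Set (Set (F × F))} {K L M N : Set (F × F)} {p q r : F × F}

lemma IsLine.exists_affineMap (hL : IsLine L) :
    ∃ e : (F × F) →ᵃ[F] F, ∀ p, p ∈ L ↔ e p = 0 := by
  obtain ⟨a, b, c, hab, rfl⟩ := hL
  exact ⟨(a • LinearMap.fst F F F + b • LinearMap.snd F F F).toAffineMap - AffineMap.const F _ c,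
    fun p => by simp [sub_eq_zero]⟩

lemma IsLine.eq_lineMap (hL : IsLine L) (hp : p ∈ L) (hq : q ∈ L) (hpq : p ≠ q) (hr : r ∈ L) :
    ∃ t : F, r = AffineMap.lineMap p q t := by
  obtain ⟨a, b, c, hab, rfl⟩ := hL
  obtain ⟨p₁, p₂⟩ := p
  obtain ⟨q₁, q₂⟩ := q
  obtain ⟨r₁, r₂⟩ := r
  simp only [mem_ofPred_eq] at hp hq hr
  simp only [AffineMap.lineMap_apply, vsub_eq_sub, vadd_eq_add, Prod.ext_iff,
    Prod.smul_mk, Prod.mk_sub_mk, Prod.mk_add_mk, smul_eq_mul]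
  have e1 : a * (q₁ - p₁) + b * (q₂ - p₂) = 0 := by linear_combination hq - hp
  have e2 : a * (r₁ - p₁) + b * (r₂ - p₂) = 0 := by linear_combination hr - hp
  have e3 : (q₁ - p₁) * (r₂ - p₂) = (q₂ - p₂) * (r₁ - p₁) := by
    rcases hab with h | h
    · apply mul_left_cancel₀ h
      linear_combination (r₂ - p₂) * e1 - (q₂ - p₂) * e2
    · apply mul_left_cancel₀ h
      linear_combination (q₁ - p₁) * e2 - (r₁ - p₁) * e1
  by_cases h : q₁ - p₁ = 0
  · have h' : q₂ - p₂ ≠ 0 := by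
      intro h'
      apply hpq
      rw [sub_eq_zero.1 h, sub_eq_zero.1 h']
    refine ⟨(r₂ - p₂) / (q₂ - p₂), ?_, ?_⟩
    · rw [h, zero_mul, eq_comm, mul_eq_zero] at e3
      rw [h, mul_zero, zero_add]
      exact sub_eq_zero.1 (e3.resolve_left h')
    · field_simp; ring
  · refine ⟨(r₁ - p₁) / (q₁ - p₁), ?_, ?_⟩
    · field_simp; ring
    · have : r₂ - p₂ = (q₂ - p₂) * (r₁ - p₁) / (q₁ - p₁) := by
        rw [eq_div_iff h]; linear_combination e3
      linear_combination this

lemma IsLine.lineMap_mem (hL : IsLine L) (hp : p ∈ L) (hq : q ∈ L) (t : F) :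
    AffineMap.lineMap p q t ∈ L := by
  obtain ⟨e, he⟩ := hL.exists_affineMap
  rw [he] at hp hq ⊢
  rw [AffineMap.apply_lineMap, hp, hq]
  simp

lemma IsLine.eq_of_mem (hL : IsLine L) (hM : IsLine M) (hpq : p ≠ q) (hp : p ∈ L) (hq : q ∈ L)
    (hp' : p ∈ M) (hq' : q ∈ M) : L = M := by
  ext r
  constructor
  · intro hr
    obtain ⟨t, rfl⟩ := hL.eq_lineMap hp hq hpq hr
    exact hM.lineMap_mem hp' hq' t
  · intro hr
    obtain ⟨t, rfl⟩ := hM.eq_lineMap hp' hq' hpq hr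
    exact hL.lineMap_mem hp hq t

open Classical in
/-- The intersection point of two lines. If they do not meet, the value is the origin. -/
noncomputable def meet (L M : Set (F × F)) : F × F :=
  if h : (L ∩ M).Nonempty then h.some else 0

open Classical in
lemma meet_comm (L M : Set (F × F)) : meet L M = meet M L := by
  have h {S T : Set (F × F)} (hST : S = T) :
      (if h : S.Nonempty then h.some else 0) = if h : T.Nonempty then h.some else 0 := by
    subst hST; rfl
  exact h (inter_comm L M)

namespace IsLineArrangement

lemma subset (hA : IsLineArrangement A) (h : Q ⊆ A) : IsLineArrangement Q :=
  ⟨hA.finite.subset h, fun L hL => hA.isLine L (h hL),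
    fun L hL M hM => hA.not_parallel L (h hL) M (h hM),
    fun L hL M hM N hN => hA.not_concurrent L (h hL) M (h hM) N (h hN)⟩

lemma meet_mem_left (hA : IsLineArrangement A) (hL : L ∈ A) (hM : M ∈ A) (hLM : L ≠ M) :
    meet L M ∈ L := by
  have h := hA.not_parallel L hL M hM hLM
  rw [meet, dif_pos h]
  exact h.some_mem.1

lemma meet_mem_right (hA : IsLineArrangement A) (hL : L ∈ A) (hM : M ∈ A) (hLM : L ≠ M) :
    meet L M ∈ M := by
  rw [meet_comm]
  exact hA.meet_mem_left hM hL hLM.symm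

lemma eq_of_mem (hA : IsLineArrangement A) (hL : L ∈ A) (hM : M ∈ A) (hLM : L ≠ M)
    (hp : p ∈ L) (hp' : p ∈ M) (hq : q ∈ L) (hq' : q ∈ M) : p = q := by
  by_contra h
  exact hLM ((hA.isLine L hL).eq_of_mem (hA.isLine M hM) h hp hq hp' hq')

lemma eq_meet (hA : IsLineArrangement A) (hL : L ∈ A) (hM : M ∈ A) (hLM : L ≠ M)
    (hp : p ∈ L) (hp' : p ∈ M) : p = meet L M :=
  hA.eq_of_mem hL hM hLM hp hp' (hA.meet_mem_left hL hM hLM) (hA.meet_mem_right hL hM hLM)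

lemma eq_or_eq (hA : IsLineArrangement A) (hL : L ∈ A) (hM : M ∈ A) (hN : N ∈ A) (hLM : L ≠ M)
    (hp : p ∈ L) (hp' : p ∈ M) (hp'' : p ∈ N) : N = L ∨ N = M := by
  by_contra! h
  have := hA.not_concurrent L hL M hM N hN hLM h.1.symm h.2.symm
  exact (this ▸ (⟨⟨hp, hp'⟩, hp''⟩ : p ∈ L ∩ M ∩ N) : p ∈ (∅ : Set (F × F)))

lemma meet_notMem (hA : IsLineArrangement A) (hL : L ∈ A) (hM : M ∈ A) (hN : N ∈ A)
    (hLM : L ≠ M) (hLN : L ≠ N) (hMN : M ≠ N) : meet L M ∉ N := fun h =>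
  (hA.eq_or_eq hL hM hN hLM (hA.meet_mem_left hL hM hLM) (hA.meet_mem_right hL hM hLM) h).elim
    hLN.symm hMN.symm

lemma meet_mem_vertices (hA : IsLineArrangement A) (hL : L ∈ A) (hM : M ∈ A) (hLM : L ≠ M) :
    meet L M ∈ vertices A :=
  ⟨L, hL, M, hM, hLM, hA.meet_mem_left hL hM hLM, hA.meet_mem_right hL hM hLM⟩

lemma exists_other_line (hp : p ∈ vertices A) (L : Set (F × F)) :
    ∃ M ∈ A, M ≠ L ∧ p ∈ M := by
  obtain ⟨M, hM, N, hN, hMN, hpM, hpN⟩ := hp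
  by_cases h : M = L
  · exact ⟨N, hN, fun h' => hMN (h.trans h'.symm), hpN⟩
  · exact ⟨M, hM, h, hpM⟩

lemma exists_eq_meet (hA : IsLineArrangement A) (hL : L ∈ A) (hp : p ∈ vertices A) (hpL : p ∈ L) :
    ∃ M ∈ A, M ≠ L ∧ p = meet L M := by
  obtain ⟨M, hM, hML, hpM⟩ := exists_other_line hp L
  exact ⟨M, hM, hML, hA.eq_meet hL hM hML.symm hpL hpM⟩

lemma vertices_inter_eq (hA : IsLineArrangement A) (hL : L ∈ A) :
    vertices A ∩ L = meet L '' (A \ {L}) := by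
  ext p
  constructor
  · rintro ⟨hp, hpL⟩
    obtain ⟨M, hM, hML, rfl⟩ := hA.exists_eq_meet hL hp hpL
    exact ⟨M, ⟨hM, hML⟩, rfl⟩
  · rintro ⟨M, ⟨hM, hML⟩, rfl⟩
    exact ⟨hA.meet_mem_vertices hL hM (Ne.symm hML), hA.meet_mem_left hL hM (Ne.symm hML)⟩

lemma injOn_meet (hA : IsLineArrangement A) (hL : L ∈ A) : InjOn (meet L) (A \ {L}) := by
  rintro M ⟨hM, hML⟩ N ⟨hN, hNL⟩ h
  by_contra hMN
  have h1 := hA.meet_mem_right hL hN (Ne.symm hNL)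
  rw [← h] at h1
  exact hA.meet_notMem hL hM hN (Ne.symm hML) (Ne.symm hNL) hMN h1

lemma meet_ne (hA : IsLineArrangement A) (hL : L ∈ A) (hM : M ∈ A) (hN : N ∈ A)
    (hLM : L ≠ M) (hLN : L ≠ N) (hMN : M ≠ N) : meet L M ≠ meet L N := fun h =>
  hMN (hA.injOn_meet hL ⟨hM, hLM.symm⟩ ⟨hN, hLN.symm⟩ h)

lemma ncard_vertices_inter (hA : IsLineArrangement A) (hL : L ∈ A) :
    (vertices A ∩ L).ncard + 1 = A.ncard := by
  rw [hA.vertices_inter_eq hL, (hA.injOn_meet hL).ncard_image,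
    ncard_sdiff_singleton_add_one hL hA.finite]

lemma finite_vertices (hA : IsLineArrangement A) : (vertices A).Finite := by
  refine ((hA.finite.prod hA.finite).image fun x => meet x.1 x.2).subset ?_
  rintro p ⟨L, hL, M, hM, hLM, hpL, hpM⟩
  exact ⟨(L, M), ⟨hL, hM⟩, (hA.eq_meet hL hM hLM hpL hpM).symm⟩

end IsLineArrangement

lemma exists_mem_notMem_finset {α : Type*} (S : Set α) (T : Finset α)
    (h : T.card < S.ncard) : ∃ x ∈ S, x ∉ T := by
  by_contra! hcon
  have : S ⊆ (T : Set α) := hcon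
  have := ncard_le_ncard this (Finset.finite_toSet T)
  rw [ncard_coe_finset] at this
  omega

/-- The point map `φ` and the line map `σ` form an isomorphism of the incidence structures of the
arrangements `A` and `B`. -/
structure IsIncidenceIso (A B : Set (Set (F × F))) (φ : F × F → F × F)
    (σ : Set (F × F) → Set (F × F)) : Prop where
  bijOn_lines : BijOn σ A B
  bijOn : BijOn φ (vertices A) (vertices B)
  mem_iff : ∀ L ∈ A, ∀ p ∈ vertices A, φ p ∈ σ L ↔ p ∈ L

/-- A collineation isomorphism maps the points of each line into a line. With three lines any two
intersection points lie on a common line, with more lines the assumption on collinear triples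
applies. -/
lemma IsCollineationIso.exists_line (hA : IsLineArrangement A) (hB : IsLineArrangement B)
    (hcard : A.ncard = B.ncard) (h3 : 3 ≤ A.ncard) {φ : F × F → F × F}
    (hφ : IsCollineationIso A B φ) (hL : L ∈ A) :
    ∃ M ∈ B, ∀ p ∈ vertices A, p ∈ L → φ p ∈ M := by
  have hLc := hA.ncard_vertices_inter hL
  have hfin : (vertices A ∩ L).Finite := hA.finite_vertices.inter_of_left _
  obtain ⟨p, ⟨hp, hpL⟩, -⟩ := exists_mem_notMem_finset (vertices A ∩ L) ∅ (by simp; omega)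
  obtain ⟨q, ⟨hq, hqL⟩, hqp⟩ := exists_mem_notMem_finset (vertices A ∩ L) {p} (by simp; omega)
  rw [Finset.mem_singleton] at hqp
  have hne : φ p ≠ φ q := fun h => hqp (hφ.bijOn.injOn hp hq h).symm
  by_cases h4 : A.ncard = 3
  · -- a second line through each of the points `φ p` and `φ q`
    obtain ⟨M, hM, hpqM⟩ : ∃ M ∈ B, φ p ∈ M ∧ φ q ∈ M := by
      obtain ⟨M, hM, N, hN, hMN, hpM, hpN⟩ := hφ.bijOn.mapsTo hp
      obtain ⟨M', hM', N', hN', hMN', hqM, hqN⟩ := hφ.bijOn.mapsTo hq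
      by_contra! hcon
      have h1 : ({M, N} : Set (Set (F × F))) ∪ {M', N'} ⊆ B := by
        rintro _ ((rfl | rfl) | (rfl | rfl)) <;> assumption
      have h2 : Disjoint ({M, N} : Set (Set (F × F))) {M', N'} := by
        rw [Set.disjoint_left]
        rintro _ (rfl | rfl) (rfl | rfl)
        · exact hcon _ hM hpM hqM
        · exact hcon _ hM hpM hqN
        · exact hcon _ hN hpN hqM
        · exact hcon _ hN hpN hqN
      have h5 := ncard_le_ncard h1 hB.finite
      rw [ncard_union_eq h2, ncard_pair hMN, ncard_pair hMN'] at h5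
      omega
    refine ⟨M, hM, fun r hr hrL => ?_⟩
    have h5 : ({p, q} : Set (F × F)) = vertices A ∩ L := by
      refine eq_of_subset_of_ncard_le ?_ ?_ hfin
      · rintro _ (rfl | rfl)
        exacts [⟨hp, hpL⟩, ⟨hq, hqL⟩]
      · rw [ncard_pair (Ne.symm hqp)]; omega
    have h6 : r ∈ ({p, q} : Set (F × F)) := h5 ▸ ⟨hr, hrL⟩
    rcases h6 with rfl | rfl
    exacts [hpqM.1, hpqM.2]
  · obtain ⟨r, ⟨hr, hrL⟩, hrpq⟩ := exists_mem_notMem_finset (vertices A ∩ L) {p, q} (by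
      rw [Finset.card_pair (Ne.symm hqp)]; omega)
    simp only [Finset.mem_insert, Finset.mem_singleton, not_or] at hrpq
    obtain ⟨M, hM, hpM, hqM, hrM⟩ := hφ.collinear p hp q hq r hr (Ne.symm hqp) (Ne.symm hrpq.1)
      (Ne.symm hrpq.2) ⟨L, hL, hpL, hqL, hrL⟩
    refine ⟨M, hM, fun s hs hsL => ?_⟩
    by_cases hsp : s = p
    · rwa [hsp]
    by_cases hsq : s = q
    · rwa [hsq]
    obtain ⟨N, hN, hpN, hqN, hsN⟩ := hφ.collinear p hp q hq s hs (Ne.symm hqp) (Ne.symm hsp)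
      (Ne.symm hsq) ⟨L, hL, hpL, hqL, hsL⟩
    rwa [(hB.isLine M hM).eq_of_mem (hB.isLine N hN) hne hpM hqM hpN hqN]

/-- A collineation isomorphism of arrangements of at least three lines comes with a bijection of
the lines that respects incidence in both directions. -/
lemma IsCollineationIso.exists_isIncidenceIso (hA : IsLineArrangement A)
    (hB : IsLineArrangement B) (hcard : A.ncard = B.ncard) (h3 : 3 ≤ A.ncard)
    {φ : F × F → F × F} (hφ : IsCollineationIso A B φ) : ∃ σ, IsIncidenceIso A B φ σ := by
  have := fun L hL => hφ.exists_line hA hB hcard h3 (L := L) hL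
  choose! σ hσB hσ using this
  -- by counting, the points of `L` are mapped onto those of `σ L`
  have himg : ∀ L ∈ A, φ '' (vertices A ∩ L) = vertices B ∩ σ L := by
    intro L hL
    refine eq_of_subset_of_ncard_le ?_ ?_ (hB.finite_vertices.inter_of_left _)
    · rintro _ ⟨p, ⟨hp, hpL⟩, rfl⟩
      exact ⟨hφ.bijOn.mapsTo hp, hσ L hL p hp hpL⟩
    · rw [(hφ.bijOn.injOn.mono inter_subset_left).ncard_image]
      have h1 := hA.ncard_vertices_inter hL
      have h2 := hB.ncard_vertices_inter (hσB L hL)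
      omega
  have hiff : ∀ L ∈ A, ∀ p ∈ vertices A, φ p ∈ σ L ↔ p ∈ L := by
    refine fun L hL p hp => ⟨fun h => ?_, hσ L hL p hp⟩
    have h' : φ p ∈ φ '' (vertices A ∩ L) := himg L hL ▸ ⟨hφ.bijOn.mapsTo hp, h⟩
    obtain ⟨q, ⟨hq, hqL⟩, hqp⟩ := h'
    rwa [← hφ.bijOn.injOn hq hp hqp]
  have hinj : InjOn σ A := by
    intro L hL M hM h
    by_contra hLM
    obtain ⟨N, hN, hN'⟩ := exists_mem_notMem_finset A {L, M} (by
      rw [Finset.card_pair hLM]; omega)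
    simp only [Finset.mem_insert, Finset.mem_singleton, not_or] at hN'
    have h1 := hA.meet_mem_vertices hN hL hN'.1
    have h2 := (hiff L hL _ h1).2 (hA.meet_mem_right hN hL hN'.1)
    rw [h, hiff M hM _ h1] at h2
    exact hA.meet_notMem hN hL hM hN'.1 hN'.2 hLM h2
  refine ⟨σ, ⟨hσB, hinj, ?_⟩, hφ.bijOn, hiff⟩
  have : σ '' A = B := by
    refine eq_of_subset_of_ncard_le ?_ ?_ hB.finite
    · rintro _ ⟨L, hL, rfl⟩; exact hσB L hL
    · rw [hinj.ncard_image, hcard]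
  rw [← this]
  exact surjOn_image σ A

namespace IsIncidenceIso

variable {φ : F × F → F × F} {σ : Set (F × F) → Set (F × F)}

lemma ne (h : IsIncidenceIso A B φ σ) (hL : L ∈ A) (hM : M ∈ A) (hLM : L ≠ M) : σ L ≠ σ M :=
  fun h' => hLM (h.bijOn_lines.injOn hL hM h')

lemma apply_meet (h : IsIncidenceIso A B φ σ) (hA : IsLineArrangement A)
    (hB : IsLineArrangement B) (hL : L ∈ A) (hM : M ∈ A) (hLM : L ≠ M) :
    φ (meet L M) = meet (σ L) (σ M) :=
  hB.eq_meet (h.bijOn_lines.mapsTo hL) (h.bijOn_lines.mapsTo hM) (h.ne hL hM hLM)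
    ((h.mem_iff L hL _ (hA.meet_mem_vertices hL hM hLM)).2 (hA.meet_mem_left hL hM hLM))
    ((h.mem_iff M hM _ (hA.meet_mem_vertices hL hM hLM)).2 (hA.meet_mem_right hL hM hLM))

/-- With at least three lines, each line contains two intersection points, so that the lines that
contain the image of `vertices A ∩ L` are determined by `L`. -/
lemma imageLines_eq (h : IsIncidenceIso A B φ σ) (hA : IsLineArrangement A)
    (hB : IsLineArrangement B) (h3 : 3 ≤ A.ncard) (hQ : Q ⊆ A) :
    imageLines A B φ Q = σ '' Q := by
  ext M
  constructor
  · rintro ⟨hM, L, hLQ, hLM⟩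
    have hL := hQ hLQ
    have hLc := hA.ncard_vertices_inter hL
    have hfin : (vertices A ∩ L).Finite := hA.finite_vertices.inter_of_left _
    obtain ⟨p, ⟨hp, hpL⟩, -⟩ := exists_mem_notMem_finset (vertices A ∩ L) ∅ (by simp; omega)
    obtain ⟨q, ⟨hq, hqL⟩, hqp⟩ := exists_mem_notMem_finset (vertices A ∩ L) {p} (by simp; omega)
    rw [Finset.mem_singleton] at hqp
    have hσ := h.bijOn_lines.mapsTo hL
    exact ⟨L, hLQ, (hB.isLine _ hσ).eq_of_mem (hB.isLine _ hM)
      (fun h' => hqp (h.bijOn.injOn hp hq h').symm) ((h.mem_iff L hL p hp).2 hpL)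
      ((h.mem_iff L hL q hq).2 hqL) (hLM ⟨p, ⟨hp, hpL⟩, rfl⟩) (hLM ⟨q, ⟨hq, hqL⟩, rfl⟩)⟩
  · rintro ⟨L, hL, rfl⟩
    refine ⟨h.bijOn_lines.mapsTo (hQ hL), L, hL, ?_⟩
    rintro _ ⟨p, ⟨hp, hpL⟩, rfl⟩
    exact (h.mem_iff L (hQ hL) p hp).2 hpL

lemma restrict (h : IsIncidenceIso A B φ σ) (hA : IsLineArrangement A)
    (hB : IsLineArrangement B) (hQ : Q ⊆ A) : IsIncidenceIso Q (σ '' Q) φ σ := by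
  have hsub : vertices Q ⊆ vertices A := fun p ⟨L, hL, M, hM, hp⟩ =>
    ⟨L, hQ hL, M, hQ hM, hp⟩
  refine ⟨⟨mapsTo_image _ _, h.bijOn_lines.injOn.mono hQ, surjOn_image _ _⟩,
    ⟨?_, h.bijOn.injOn.mono hsub, ?_⟩, fun L hL p hp => h.mem_iff L (hQ hL) p (hsub hp)⟩
  · intro p hp
    have hp' := hsub hp
    obtain ⟨L, hL, M, hM, hLM, hpL, hpM⟩ := hp
    exact ⟨σ L, mem_image_of_mem _ hL, σ M, mem_image_of_mem _ hM, h.ne (hQ hL) (hQ hM) hLM,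
      (h.mem_iff L (hQ hL) p hp').2 hpL, (h.mem_iff M (hQ hM) p hp').2 hpM⟩
  · rintro p ⟨_, ⟨L, hL, rfl⟩, _, ⟨M, hM, rfl⟩, hLM, hpL, hpM⟩
    have hne : L ≠ M := fun h' => hLM (h' ▸ rfl)
    have hQa := hA.subset hQ
    refine ⟨meet L M, hQa.meet_mem_vertices hL hM hne, ?_⟩
    rw [h.apply_meet hA hB (hQ hL) (hQ hM) hne]
    exact (hB.eq_meet (h.bijOn_lines.mapsTo (hQ hL)) (h.bijOn_lines.mapsTo (hQ hM)) hLM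
      hpL hpM).symm

end IsIncidenceIso

end Incidence

/-! ### Betweenness on the lines of an arrangement -/

section Betweenness

variable {F : Type*} [Field F] [LinearOrder F] [IsStrictOrderedRing F]
  {A B Q : Set (Set (F × F))} {K L M N : Set (F × F)} {p q r : F × F}

lemma sbtw_add_smul_iff {w : F × F} (hw : w ≠ 0) {a b : F} :
    Sbtw F (p + a • w) p (p + b • w) ↔ a * b < 0 := by
  constructor
  · intro h
    obtain ⟨⟨t, ht, htp⟩, -⟩ := (sbtw_iff_mem_image_Ioo_and_ne.1 h)
    have h1 : (a * (1 - t) + t * b) • w = 0 := by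
      have : p + (a * (1 - t) + t * b) • w = p := by
        nth_rewrite 2 [← htp]
        rw [AffineMap.lineMap_apply]
        simp only [vsub_eq_sub, vadd_eq_add]
        module
      simpa using this
    have h2 := (smul_eq_zero.1 h1).resolve_right hw
    have hb : b ≠ 0 := by
      rintro rfl
      exact h.2.2 (by simp)
    have h3 : 0 < t * b ^ 2 := mul_pos ht.1 (by positivity)
    have h4 : (1 - t) * (a * b) = -(t * b ^ 2) := by linear_combination b * h2
    by_contra! hab
    have := mul_nonneg (sub_nonneg.2 ht.2.le) hab
    linarith
  · intro hab
    have hne : a - b ≠ 0 := by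
      intro h
      rw [sub_eq_zero.1 h] at hab
      nlinarith [mul_self_nonneg b]
    have h1 : AffineMap.lineMap (p + a • w) (p + b • w) (a / (a - b)) = p := by
      rw [AffineMap.lineMap_apply]
      simp only [vsub_eq_sub, vadd_eq_add]
      have : (a / (a - b)) • (p + b • w - (p + a • w)) + (p + a • w) =
          p + (a / (a - b) * (b - a) + a) • w := by module
      rw [this]
      have : a / (a - b) * (b - a) + a = 0 := by field_simp; ring
      rw [this]; simp
    have h2 := sbtw_lineMap_iff (R := F) (x := p + a • w) (y := p + b • w) (r := a / (a - b))
    rw [h1] at h2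
    rw [h2]
    refine ⟨fun h => hne ?_, ?_⟩
    · have : (a - b) • w = 0 := by
        rw [sub_smul, sub_eq_zero]; exact add_left_cancel h
      exact (smul_eq_zero.1 this).resolve_right hw
    · rcases mul_neg_iff.1 hab with ⟨ha, hb⟩ | ⟨ha, hb⟩
      · have : 0 < a - b := by linarith
        exact ⟨by positivity, by rw [div_lt_one this]; linarith⟩
      · have : a - b < 0 := by linarith
        exact ⟨div_pos_of_neg_of_neg ha this, by rw [div_lt_one_of_neg this]; linarith⟩

lemma IsLine.exists_smul (hL : IsLine L) {w : F × F} (hp : p ∈ L) (hw : w ≠ 0) (hpw : p + w ∈ L)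
    (hq : q ∈ L) : ∃ a : F, q = p + a • w := by
  obtain ⟨t, rfl⟩ := hL.eq_lineMap hp hpw (by simpa using hw) hq
  exact ⟨t, by rw [AffineMap.lineMap_apply]; simp [add_comm]⟩

/-- A point of a line separates two others if and only if these lie on different sides of a
transversal through the first point. -/
lemma IsLine.sbtw_iff_mul_neg (hL : IsLine L) (hp : p ∈ L) (hq : q ∈ L) (hr : r ∈ L)
    (e : (F × F) →ᵃ[F] F) (he : e p = 0) (heq : e q ≠ 0) : Sbtw F q p r ↔ e q * e r < 0 := by
  have hqp : q - p ≠ 0 := by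
    intro h
    rw [sub_eq_zero.1 h] at heq
    exact heq he
  have he' : ∀ a : F, e (p + a • (q - p)) = a * e q := by
    intro a
    have : p + a • (q - p) = AffineMap.lineMap p q a := by
      rw [AffineMap.lineMap_apply]; simp [add_comm]
    rw [this, AffineMap.apply_lineMap, he, AffineMap.lineMap_apply]
    simp
  obtain ⟨b, rfl⟩ := hL.exists_smul hp hqp (by simpa using hq) hr
  have h1 := sbtw_add_smul_iff (p := p) hqp (a := 1) (b := b)
  rw [one_smul, add_sub_cancel, one_mul] at h1
  rw [h1, he', mul_comm, mul_assoc, mul_neg_iff]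
  have : 0 < e q * e q := mul_self_pos.2 heq
  constructor
  · intro h; exact Or.inr ⟨h, this⟩
  · rintro (⟨-, h⟩ | ⟨h, -⟩)
    · exact absurd h this.not_gt
    · exact h

lemma apply_of_sbtw (e : (F × F) →ᵃ[F] F) (he : e p = 0) (h : Sbtw F p q r) :
    ∃ t : F, 0 < t ∧ t < 1 ∧ e q = t * e r := by
  obtain ⟨⟨t, ht, rfl⟩, -⟩ := sbtw_iff_mem_image_Ioo_and_ne.1 h
  refine ⟨t, ht.1, ht.2, ?_⟩
  rw [AffineMap.apply_lineMap, he, AffineMap.lineMap_apply]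
  simp

lemma IsLine.sbtw_or_sbtw_or_sbtw (hL : IsLine L) (hp : p ∈ L) (hq : q ∈ L) (hr : r ∈ L)
    (hpq : p ≠ q) (hpr : p ≠ r) (hqr : q ≠ r) :
    Sbtw F q p r ∨ Sbtw F p q r ∨ Sbtw F p r q := by
  obtain ⟨t, rfl⟩ := hL.eq_lineMap hp hq hpq hr
  have hcol : Collinear F {p, q, AffineMap.lineMap p q t} := by
    rw [collinear_iff_of_mem (p₀ := p) (by simp)]
    refine ⟨q - p, ?_⟩
    rintro x (rfl | rfl | rfl)
    · exact ⟨0, by simp⟩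
    · exact ⟨1, by simp⟩
    · exact ⟨t, by rw [AffineMap.lineMap_apply]; simp⟩
  rcases hcol.wbtw_or_wbtw_or_wbtw with h | h | h
  · exact Or.inr (Or.inl ⟨h, hpq.symm, hqr⟩)
  · exact Or.inr (Or.inr ⟨h.symm, hpr.symm, hqr.symm⟩)
  · exact Or.inl ⟨h.symm, hpq, hpr⟩

lemma not_sbtw_of_sbtw (h : Sbtw F q p r) : ¬ Sbtw F p q r := by
  intro h'
  exact h'.not_swap_left h.wbtw

/-! ### Four lines -/

lemma natCast_eq_one_or_neg_one_iff {n k : ℕ} (hn : n = 4) (hk : k ∈ Set.Icc 1 3) :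
    ((k : ZMod n) = 1 ∨ (k : ZMod n) = -1) ↔ k ≠ 2 := by
  subst hn
  obtain ⟨h1, h3⟩ := hk
  interval_cases k <;> decide

/-- Among three intersection points on a line, the outer ones are those that are not between the
other two. -/
lemma not_isOuterOn_iff_sbtw (hL : IsLine L) (h4 : Q.ncard = 4) (hV : vertices Q ∩ L = {p, q, r})
    (hpq : p ≠ q) (hpr : p ≠ r) (hqr : q ≠ r) : ¬ IsOuterOn Q L p ↔ Sbtw F q p r := by
  have hpL : p ∈ vertices Q ∩ L := by rw [hV]; simp
  have hqL : q ∈ vertices Q ∩ L := by rw [hV]; simp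
  have hrL : r ∈ vertices Q ∩ L := by rw [hV]; simp
  have key : ∀ w, IsDirection L w →
      innerCoord Q L w p ∈ Set.Icc 1 3 ∧ (innerCoord Q L w p = 2 ↔ Sbtw F q p r) := by
    intro w hw
    have hmem : ∀ a : F, (∃ t : F, 0 ≤ t ∧ p = p + a • w + t • w) ↔ a ≤ 0 := by
      intro a
      constructor
      · rintro ⟨t, ht, h⟩
        have : (a + t) • w = 0 := by
          rw [add_smul, ← add_eq_left (a := p), ← add_assoc]; exact h.symm
        have := (smul_eq_zero.1 this).resolve_right hw.1
        linarith
      · intro ha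
        exact ⟨-a, by linarith, by module⟩
    obtain ⟨a, ha⟩ := hL.exists_smul hpL.2 hw.1 (hw.2 p hpL.2) hqL.2
    obtain ⟨b, hb⟩ := hL.exists_smul hpL.2 hw.1 (hw.2 p hpL.2) hrL.2
    have ha0 : a ≠ 0 := by rintro rfl; exact hpq (by simpa using ha.symm)
    have hb0 : b ≠ 0 := by rintro rfl; exact hpr (by simpa using hb.symm)
    have hset : {x | x ∈ vertices Q ∧ x ∈ L ∧ ∃ t : F, 0 ≤ t ∧ p = x + t • w} =
        {x | x = p ∨ (x = q ∧ a < 0) ∨ (x = r ∧ b < 0)} := by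
      ext x
      have hx : x ∈ vertices Q ∧ x ∈ L ↔ x = p ∨ x = q ∨ x = r := by
        change x ∈ vertices Q ∩ L ↔ _
        rw [hV]; simp
      rw [mem_ofPred_eq, mem_ofPred_eq, ← and_assoc, hx]
      have e1 : (∃ t : F, 0 ≤ t ∧ p = p + t • w) := ⟨0, le_rfl, by simp⟩
      have e2 : (∃ t : F, 0 ≤ t ∧ p = q + t • w) ↔ a < 0 := by
        rw [ha, hmem]; exact ⟨fun h => lt_of_le_of_ne h ha0, le_of_lt⟩
      have e3 : (∃ t : F, 0 ≤ t ∧ p = r + t • w) ↔ b < 0 := by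
        rw [hb, hmem]; exact ⟨fun h => lt_of_le_of_ne h hb0, le_of_lt⟩
      constructor
      · rintro ⟨rfl | rfl | rfl, h⟩
        · exact Or.inl rfl
        · exact Or.inr (Or.inl ⟨rfl, e2.1 h⟩)
        · exact Or.inr (Or.inr ⟨rfl, e3.1 h⟩)
      · rintro (rfl | ⟨rfl, h⟩ | ⟨rfl, h⟩)
        · exact ⟨Or.inl rfl, e1⟩
        · exact ⟨Or.inr (Or.inl rfl), e2.2 h⟩
        · exact ⟨Or.inr (Or.inr rfl), e3.2 h⟩
    have hs : Sbtw F q p r ↔ a * b < 0 := by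
      rw [ha, hb]; exact sbtw_add_smul_iff hw.1
    rw [hs, innerCoord, hset]
    rcases lt_or_gt_of_ne ha0 with h1 | h1 <;> rcases lt_or_gt_of_ne hb0 with h2 | h2
    · have : {x | x = p ∨ (x = q ∧ a < 0) ∨ (x = r ∧ b < 0)} = {p, q, r} := by
        ext x; simp [h1, h2]
      rw [this, ncard_eq_three.2 ⟨p, q, r, hpq, hpr, hqr, rfl⟩]
      simp [(mul_pos_of_neg_of_neg h1 h2).le]
    · have : {x | x = p ∨ (x = q ∧ a < 0) ∨ (x = r ∧ b < 0)} = {p, q} := by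
        ext x; simp [h1, h2.not_gt]
      rw [this, ncard_pair hpq]
      simp [mul_neg_of_neg_of_pos h1 h2]
    · have : {x | x = p ∨ (x = q ∧ a < 0) ∨ (x = r ∧ b < 0)} = {p, r} := by
        ext x; simp [h1.not_gt, h2]
      rw [this, ncard_pair hpr]
      simp [mul_neg_of_pos_of_neg h1 h2]
    · have : {x | x = p ∨ (x = q ∧ a < 0) ∨ (x = r ∧ b < 0)} = {p} := by
        ext x; simp [h1.not_gt, h2.not_gt]
      rw [this, ncard_singleton]
      simp [(mul_pos h1 h2).le]
  have hdir : IsDirection L (q - p) := by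
    refine ⟨sub_ne_zero.2 hpq.symm, fun x hx => ?_⟩
    obtain ⟨e, he⟩ := hL.exists_affineMap
    have h1 := e.map_vadd x (q - p)
    have h2 := e.linearMap_vsub q p
    simp only [vsub_eq_sub, vadd_eq_add] at h1 h2
    rw [he, add_comm, h1, h2, (he q).1 hqL.2, (he p).1 hpL.2, (he x).1 hx]
    simp
  have hiff : ∀ w, IsDirection L w → (((innerCoord Q L w p : ZMod Q.ncard) = 1 ∨
      (innerCoord Q L w p : ZMod Q.ncard) = -1) ↔ ¬ Sbtw F q p r) := fun w hw => by
    rw [natCast_eq_one_or_neg_one_iff h4 (key w hw).1, ne_eq, (key w hw).2]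
  constructor
  · intro h
    by_contra hcon
    exact h fun w hw => (hiff w hw).2 hcon
  · intro h hout
    exact (hiff _ hdir).1 (hout _ hdir) h

/-- `Q` is the line arrangement that consists of the four distinct lines `L`, `M`, `N`, `K`. -/
structure IsQuadruple (Q : Set (Set (F × F))) (L M N K : Set (F × F)) : Prop where
  arr : IsLineArrangement Q
  eq : Q = {L, M, N, K}
  hLM : L ≠ M
  hLN : L ≠ N
  hLK : L ≠ K
  hMN : M ≠ N
  hMK : M ≠ K
  hNK : N ≠ K

/-- On the line `L`, the intersection point with `M` is between those with `N` and `K`. -/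
def IsMid (L M N K : Set (F × F)) : Prop :=
  Sbtw F (meet L N) (meet L M) (meet L K)

lemma isMid_comm : IsMid L M N K ↔ IsMid L M K N := sbtw_comm

namespace IsQuadruple

lemma swap₁₂ (h : IsQuadruple Q L M N K) : IsQuadruple Q M L N K :=
  ⟨h.arr, h.eq.trans (insert_comm _ _ _), h.hLM.symm, h.hMN, h.hMK, h.hLN, h.hLK, h.hNK⟩

lemma swap₂₃ (h : IsQuadruple Q L M N K) : IsQuadruple Q L N M K :=
  ⟨h.arr, h.eq.trans (by rw [insert_comm M]), h.hLN, h.hLM, h.hLK, h.hMN.symm, h.hNK, h.hMK⟩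

lemma swap₃₄ (h : IsQuadruple Q L M N K) : IsQuadruple Q L M K N :=
  ⟨h.arr, h.eq.trans (by rw [pair_comm N]), h.hLM, h.hLK, h.hLN, h.hMK, h.hMN, h.hNK.symm⟩

lemma mem₁ (h : IsQuadruple Q L M N K) : L ∈ Q := by rw [h.eq]; simp
lemma mem₂ (h : IsQuadruple Q L M N K) : M ∈ Q := h.swap₁₂.mem₁
lemma mem₃ (h : IsQuadruple Q L M N K) : N ∈ Q := h.swap₂₃.mem₂
lemma mem₄ (h : IsQuadruple Q L M N K) : K ∈ Q := h.swap₃₄.mem₃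

lemma ncard (h : IsQuadruple Q L M N K) : Q.ncard = 4 := by
  rw [h.eq, ncard_insert_of_notMem (by simp [h.hLM, h.hLN, h.hLK]),
    ncard_eq_three.2 ⟨M, N, K, h.hMN, h.hMK, h.hNK, rfl⟩]

lemma eq_or (h : IsQuadruple Q L M N K) {X : Set (F × F)} (hX : X ∈ Q) :
    X = L ∨ X = M ∨ X = N ∨ X = K := by
  rw [h.eq] at hX; simpa using hX

lemma not_isOuterOn_iff (h : IsQuadruple Q L M N K) :
    ¬ IsOuterOn Q L (meet L M) ↔ IsMid L M N K := by
  refine not_isOuterOn_iff_sbtw (h.arr.isLine L h.mem₁) h.ncard ?_ ?_ ?_ ?_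
  · rw [h.arr.vertices_inter_eq h.mem₁]
    have : Q \ {L} = {M, N, K} := by
      rw [h.eq]
      ext X
      have := h.hLM; have := h.hLN; have := h.hLK
      simp only [mem_sdiff, mem_insert_iff, mem_singleton_iff]
      grind
    rw [this]
    simp [image_insert_eq]
  · exact h.arr.meet_ne h.mem₁ h.mem₂ h.mem₃ h.hLM h.hLN h.hMN
  · exact h.arr.meet_ne h.mem₁ h.mem₂ h.mem₄ h.hLM h.hLK h.hMK
  · exact h.arr.meet_ne h.mem₁ h.mem₃ h.mem₄ h.hLN h.hLK h.hNK

lemma isMid_or (h : IsQuadruple Q L M N K) :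
    IsMid L M N K ∨ IsMid L N M K ∨ IsMid L K M N :=
  (h.arr.isLine L h.mem₁).sbtw_or_sbtw_or_sbtw (h.arr.meet_mem_left h.mem₁ h.mem₂ h.hLM)
    (h.arr.meet_mem_left h.mem₁ h.mem₃ h.hLN) (h.arr.meet_mem_left h.mem₁ h.mem₄ h.hLK)
    (h.arr.meet_ne h.mem₁ h.mem₂ h.mem₃ h.hLM h.hLN h.hMN)
    (h.arr.meet_ne h.mem₁ h.mem₂ h.mem₄ h.hLM h.hLK h.hMK)
    (h.arr.meet_ne h.mem₁ h.mem₃ h.mem₄ h.hLN h.hLK h.hNK)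

lemma isMid_iff_mul_neg (h : IsQuadruple Q L M N K) {e : (F × F) →ᵃ[F] F}
    (he : ∀ p, p ∈ M ↔ e p = 0) : IsMid L M N K ↔ e (meet L N) * e (meet L K) < 0 :=
  (h.arr.isLine L h.mem₁).sbtw_iff_mul_neg (h.arr.meet_mem_left h.mem₁ h.mem₂ h.hLM)
    (h.arr.meet_mem_left h.mem₁ h.mem₃ h.hLN) (h.arr.meet_mem_left h.mem₁ h.mem₄ h.hLK) e
    ((he _).1 (h.arr.meet_mem_right h.mem₁ h.mem₂ h.hLM))
    (fun h0 => h.arr.meet_notMem h.mem₁ h.mem₃ h.mem₂ h.hLN h.hLM h.hMN.symm ((he _).2 h0))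

end IsQuadruple

lemma IsMid.not_swap (h : IsMid L M N K) : ¬ IsMid L N M K := not_sbtw_of_sbtw h

namespace IsQuadruple

/-- Pasch's axiom: the line `M` separates an even number of pairs of vertices of the triangle
`L`, `N`, `K`. -/
lemma pasch (h : IsQuadruple Q L M N K) (h₁ : IsMid L M N K) (h₂ : ¬ IsMid N M L K)
    (h₃ : ¬ IsMid K M L N) : False := by
  obtain ⟨e, he⟩ := (h.arr.isLine M h.mem₂).exists_affineMap
  have hN : IsQuadruple Q N M L K := h.swap₂₃.swap₁₂.swap₂₃
  have hK : IsQuadruple Q K M L N := h.swap₃₄.swap₂₃.swap₁₂.swap₂₃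
  rw [h.isMid_iff_mul_neg he] at h₁
  rw [hN.isMid_iff_mul_neg he, not_lt] at h₂
  rw [hK.isMid_iff_mul_neg he, not_lt] at h₃
  rw [meet_comm N L] at h₂
  rw [meet_comm K L, meet_comm K N] at h₃
  have h0 : e (meet N K) ≠ 0 := fun h0 =>
    h.arr.meet_notMem h.mem₃ h.mem₄ h.mem₂ h.hNK h.hMN.symm h.hMK.symm ((he _).2 h0)
  have h4 := mul_nonneg h₂ h₃
  have h5 : 0 < e (meet N K) ^ 2 := by positivity
  nlinarith [mul_neg_of_neg_of_pos h₁ h5]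

lemma abs_lt (h : IsQuadruple Q M L N K) (h₁ : IsMid M L N K) {e : (F × F) →ᵃ[F] F}
    (he : ∀ p, p ∈ K ↔ e p = 0) : |e (meet L M)| < |e (meet M N)| := by
  obtain ⟨t, ht, ht', hte⟩ := apply_of_sbtw e
    ((he _).1 (h.arr.meet_mem_right h.mem₁ h.mem₄ h.hLK)) h₁.symm
  have h0 : e (meet M N) ≠ 0 := fun h0 =>
    h.arr.meet_notMem h.mem₁ h.mem₃ h.mem₄ h.hLN h.hLK h.hNK ((he _).2 h0)
  rw [meet_comm L M, hte, abs_mul, abs_of_pos ht]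
  have : 0 < |e (meet M N)| := by positivity
  nlinarith

/-- The middle points of three lines do not form a cycle: the distances of the vertices of the
triangle `L`, `M`, `N` from the line `K`, measured by a linear form, would decrease along the
cycle. -/
lemma not_cycle (h : IsQuadruple Q L M N K) (h₁ : IsMid M L N K) (h₂ : IsMid L N M K)
    (h₃ : IsMid N M L K) : False := by
  obtain ⟨e, he⟩ := (h.arr.isLine K h.mem₄).exists_affineMap
  have e1 := h.swap₁₂.abs_lt h₁ he
  have e2 := h.swap₂₃.abs_lt h₂ he
  have e3 := h.swap₂₃.swap₁₂.swap₂₃.abs_lt h₃ he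
  exact lt_irrefl _ (e1.trans (e3.trans e2))

end IsQuadruple

end Betweenness

/-! ### Nook points and central pairs determine betweenness -/

section NookAndCentral

variable {F : Type*} [Field F] [LinearOrder F] [IsStrictOrderedRing F]
  {A B Q : Set (Set (F × F))} {K L M N : Set (F × F)} {p q r : F × F}
  {φ : F × F → F × F} {σ : Set (F × F) → Set (F × F)}

namespace IsQuadruple

lemma meet_mem_nookPoints_iff (h : IsQuadruple Q L M N K) :
    meet L M ∈ nookPoints Q ↔ IsMid L M N K ∧ IsMid M L N K := by
  have hL := h.arr.meet_mem_left h.mem₁ h.mem₂ h.hLM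
  have hM := h.arr.meet_mem_right h.mem₁ h.mem₂ h.hLM
  rw [← h.not_isOuterOn_iff, ← h.swap₁₂.not_isOuterOn_iff, meet_comm M L]
  constructor
  · rintro ⟨-, hn⟩
    exact ⟨hn L h.mem₁ hL, hn M h.mem₂ hM⟩
  · rintro ⟨h1, h2⟩
    refine ⟨h.arr.meet_mem_vertices h.mem₁ h.mem₂ h.hLM, fun X hX hpX => ?_⟩
    rcases h.arr.eq_or_eq h.mem₁ h.mem₂ hX h.hLM hL hM hpX with rfl | rfl
    exacts [h1, h2]

lemma meet_mem_extremePoints (h : IsQuadruple Q L M N K) (h1 : ¬ IsMid L M N K)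
    (h2 : ¬ IsMid M L N K) : meet L M ∈ extremePoints Q := by
  rw [← h.not_isOuterOn_iff, not_not] at h1
  rw [← h.swap₁₂.not_isOuterOn_iff, meet_comm M L, not_not] at h2
  refine ⟨h.arr.meet_mem_vertices h.mem₁ h.mem₂ h.hLM, fun X hX hpX => ?_⟩
  rcases h.arr.eq_or_eq h.mem₁ h.mem₂ hX h.hLM (h.arr.meet_mem_left h.mem₁ h.mem₂ h.hLM)
    (h.arr.meet_mem_right h.mem₁ h.mem₂ h.hLM) hpX with rfl | rfl
  exacts [h1, h2]

/-- The middle point of a line is not opposite to a nook point. -/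
lemma meet_notMem_extremeNookPoints (h : IsQuadruple Q L M N K) (h1 : IsMid L M N K) :
    meet L M ∉ extremeNookPoints Q := by
  rintro ⟨-, q, hq, hqp⟩
  obtain ⟨X, hX, Y, hY, hXY, hqX, hqY⟩ := hq.1
  have hX' := h.eq_or hX
  have hY' := h.eq_or hY
  have hL := h.arr.meet_mem_left h.mem₁ h.mem₂ h.hLM
  have hM := h.arr.meet_mem_right h.mem₁ h.mem₂ h.hLM
  have hn : ∀ Z ∈ Q, q ∈ Z → Z ≠ L ∧ Z ≠ M := fun Z hZ hqZ =>
    ⟨fun h' => hqp Z hZ hqZ (h' ▸ hL), fun h' => hqp Z hZ hqZ (h' ▸ hM)⟩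
  have hNK : q ∈ N ∧ q ∈ K := by
    have := hn X hX hqX
    have := hn Y hY hqY
    rcases hX' with rfl | rfl | rfl | rfl <;> rcases hY' with rfl | rfl | rfl | rfl <;> tauto
  rw [h.arr.eq_meet h.mem₃ h.mem₄ h.hNK hNK.1 hNK.2] at hq
  have hQ : IsQuadruple Q N K L M := h.swap₂₃.swap₁₂.swap₃₄.swap₂₃
  obtain ⟨h2, h3⟩ := hQ.meet_mem_nookPoints_iff.1 hq
  exact h.pasch h1 (fun h' => (isMid_comm.1 h2).not_swap (isMid_comm.1 h'))
    (fun h' => (isMid_comm.1 h3).not_swap (isMid_comm.1 h'))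

/-- If a line `L` contains the middle point of another line `M`, then the middle point of `L`,
say that with `N`, is also the middle point of `N`, so that it is a nook point. -/
lemma isMid_of_isMid (h : IsQuadruple Q L M N K) (h1 : IsMid M L N K) (h2 : IsMid L N M K) :
    IsMid N L M K := by
  have hN : IsQuadruple Q N L M K := h.swap₂₃.swap₁₂
  rcases hN.isMid_or with h3 | h3 | h3
  · exact h3
  · exact (h.not_cycle h1 h2 h3).elim
  · -- `K` separates the vertices of the triangle `L`, `M`, `N` on `N`, but not those on `L`, `M`
    have hK : IsQuadruple Q N K L M := h.swap₂₃.swap₁₂.swap₃₄.swap₂₃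
    refine (hK.pasch h3 (fun h' => ?_) fun h' => ?_).elim
    · exact (isMid_comm.1 h2).not_swap h'
    · exact (isMid_comm.1 h1).not_swap (isMid_comm.1 h')

/-- The middle point of a line is the nook point if the line contains it, and otherwise the
central point on the line. -/
lemma not_isOuterOn_iff_nook_or_central (h : IsQuadruple Q L M N K) :
    ¬ IsOuterOn Q L (meet L M) ↔ meet L M ∈ nookPoints Q ∨
      (meet L M ∈ centralPoints Q ∧ ∀ q ∈ nookPoints Q, q ∉ L) := by
  have hL := h.arr.meet_mem_left h.mem₁ h.mem₂ h.hLM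
  rw [h.not_isOuterOn_iff]
  constructor
  · intro h1
    by_cases hn : meet L M ∈ nookPoints Q
    · exact Or.inl hn
    refine Or.inr ⟨⟨h.arr.meet_mem_vertices h.mem₁ h.mem₂ h.hLM, ?_⟩, ?_⟩
    · rintro ((h2 | h2) | h2)
      · exact hn h2
      · exact h.meet_notMem_extremeNookPoints h1 h2
      · exact h.not_isOuterOn_iff.2 h1 (h2.1.2 L h.mem₁ hL)
    · intro q hq hqL
      obtain ⟨X, hX, hXL, rfl⟩ := h.arr.exists_eq_meet h.mem₁ hq.1 hqL
      rcases h.eq_or hX with rfl | rfl | rfl | rfl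
      · exact hXL rfl
      · exact hn hq
      · exact h1.not_swap (h.swap₂₃.meet_mem_nookPoints_iff.1 hq).1
      · exact (isMid_comm.1 h1).not_swap
          (h.swap₃₄.swap₂₃.meet_mem_nookPoints_iff.1 hq).1
  · rintro (h1 | ⟨h1, h2⟩)
    · exact (h.meet_mem_nookPoints_iff.1 h1).1
    by_contra h3
    have h4 : IsMid M L N K := by
      by_contra h4
      by_cases h5 : meet L M ∈ extremeNookPoints Q
      · exact h1.2 (Or.inl (Or.inr h5))
      · exact h1.2 (Or.inr ⟨h.meet_mem_extremePoints h3 h4, h5⟩)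
    -- as `L` contains the middle point of `M`, the middle point of `L` would be a nook point
    rcases h.isMid_or.resolve_left h3 with h5 | h5
    · exact h2 _ (h.swap₂₃.meet_mem_nookPoints_iff.2 ⟨h5, h.isMid_of_isMid h4 h5⟩)
        (h.arr.meet_mem_left h.mem₁ h.mem₃ h.hLN)
    · exact h2 _ (h.swap₃₄.swap₂₃.meet_mem_nookPoints_iff.2
        ⟨h5, h.swap₃₄.isMid_of_isMid (isMid_comm.1 h4) h5⟩)
        (h.arr.meet_mem_left h.mem₁ h.mem₄ h.hLK)

end IsQuadruple

lemma IsLineArrangement.isQuadruple (hA : IsLineArrangement A) (hL : L ∈ A) (hM : M ∈ A)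
    (hN : N ∈ A) (hK : K ∈ A) (hLM : L ≠ M) (hLN : L ≠ N) (hLK : L ≠ K) (hMN : M ≠ N)
    (hMK : M ≠ K) (hNK : N ≠ K) : IsQuadruple {L, M, N, K} L M N K := by
  refine ⟨hA.subset ?_, rfl, hLM, hLN, hLK, hMN, hMK, hNK⟩
  rintro _ (rfl | rfl | rfl | rfl) <;> assumption

namespace IsIncidenceIso

lemma isQuadruple (hσ : IsIncidenceIso A B φ σ) (hB : IsLineArrangement B) (hQ : Q ⊆ A)
    (h : IsQuadruple Q L M N K) : IsQuadruple (σ '' Q) (σ L) (σ M) (σ N) (σ K) := by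
  refine ⟨hB.subset ?_, by rw [h.eq]; simp [image_insert_eq],
    hσ.ne (hQ h.mem₁) (hQ h.mem₂) h.hLM, hσ.ne (hQ h.mem₁) (hQ h.mem₃) h.hLN,
    hσ.ne (hQ h.mem₁) (hQ h.mem₄) h.hLK, hσ.ne (hQ h.mem₂) (hQ h.mem₃) h.hMN,
    hσ.ne (hQ h.mem₂) (hQ h.mem₄) h.hMK, hσ.ne (hQ h.mem₃) (hQ h.mem₄) h.hNK⟩
  rintro _ ⟨X, hX, rfl⟩
  exact hσ.bijOn_lines.mapsTo (hQ hX)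

/-- A collineation isomorphism that respects nook points and central pairs respects
betweenness. -/
theorem isMid_iff (hσ : IsIncidenceIso A B φ σ) (hA : IsLineArrangement A)
    (hB : IsLineArrangement B) (hφ : PreservesNookAndCentral A B φ) (hL : L ∈ A) (hM : M ∈ A)
    (hN : N ∈ A) (hK : K ∈ A) (hLM : L ≠ M) (hLN : L ≠ N) (hLK : L ≠ K) (hMN : M ≠ N)
    (hMK : M ≠ K) (hNK : N ≠ K) :
    IsMid L M N K ↔ IsMid (σ L) (σ M) (σ N) (σ K) := by
  have h := hA.isQuadruple hL hM hN hK hLM hLN hLK hMN hMK hNK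
  have hQ : ({L, M, N, K} : Set (Set (F × F))) ⊆ A := by
    rintro _ (rfl | rfl | rfl | rfl) <;> assumption
  have h' := hσ.isQuadruple hB hQ h
  have h3 : 3 ≤ A.ncard := by
    have := ncard_le_ncard hQ hA.finite
    rw [h.ncard] at this
    omega
  obtain ⟨hn, hc⟩ := hφ _ hQ h.ncard
  rw [hσ.imageLines_eq hA hB h3 hQ] at hn hc
  have hr := hσ.restrict hA hB hQ
  have hp := h.arr.meet_mem_vertices h.mem₁ h.mem₂ hLM
  have key : ∀ S ⊆ vertices ({L, M, N, K} : Set (Set (F × F))),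
      meet L M ∈ S ↔ meet (σ L) (σ M) ∈ φ '' S := by
    intro S hS
    rw [← hσ.apply_meet hA hB hL hM hLM]
    refine ⟨mem_image_of_mem φ, ?_⟩
    rintro ⟨q, hq, hqp⟩
    rwa [← hr.bijOn.injOn (hS hq) hp hqp]
  rw [← h.not_isOuterOn_iff, ← h'.not_isOuterOn_iff, h.not_isOuterOn_iff_nook_or_central,
    h'.not_isOuterOn_iff_nook_or_central, ← hn, ← hc, key _ (fun x hx => hx.1),
    key _ (fun x hx => hx.1), forall_mem_image]
  have : (∀ q ∈ nookPoints {L, M, N, K}, q ∉ L) ↔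
      ∀ q ∈ nookPoints {L, M, N, K}, φ q ∉ σ L :=
    forall₂_congr fun q hq => not_congr (hr.mem_iff L h.mem₁ q hq.1).symm
  rw [this]

/-- The nook points and central points are determined by incidence and by the outer points. -/
lemma image_nookPoints_and_centralPoints (h : IsIncidenceIso A B φ σ)
    (ho : ∀ L ∈ A, ∀ p ∈ vertices A, p ∈ L → (IsOuterOn A L p ↔ IsOuterOn B (σ L) (φ p))) :
    φ '' nookPoints A = nookPoints B ∧ φ '' centralPoints A = centralPoints B := by
  have hall : ∀ P : Set (F × F) → Prop, (∀ M ∈ B, P M) ↔ ∀ L ∈ A, P (σ L) := by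
    intro P
    rw [← h.bijOn_lines.image_eq, forall_mem_image]
  have image_eq : ∀ S ⊆ vertices A, ∀ T ⊆ vertices B, (∀ p ∈ vertices A, p ∈ S ↔ φ p ∈ T) →
      φ '' S = T := by
    intro S hS T hT hST
    ext q
    constructor
    · rintro ⟨p, hp, rfl⟩
      exact (hST p (hS hp)).1 hp
    · intro hq
      obtain ⟨p, hp, rfl⟩ := h.bijOn.surjOn (hT hq)
      exact ⟨p, (hST p hp).2 hq, rfl⟩
  have hv : ∀ p ∈ vertices A, φ p ∈ vertices B := h.bijOn.mapsTo
  have hN : ∀ p ∈ vertices A, p ∈ nookPoints A ↔ φ p ∈ nookPoints B := by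
    intro p hp
    refine and_congr (iff_of_true hp (hv p hp)) ?_
    rw [hall]
    refine forall₂_congr fun L hL => ?_
    rw [h.mem_iff L hL p hp]
    exact forall_congr' fun hpL => not_congr (ho L hL p hp hpL)
  have hE : ∀ p ∈ vertices A, p ∈ extremePoints A ↔ φ p ∈ extremePoints B := by
    intro p hp
    refine and_congr (iff_of_true hp (hv p hp)) ?_
    rw [hall]
    refine forall₂_congr fun L hL => ?_
    rw [h.mem_iff L hL p hp]
    exact forall_congr' fun hpL => ho L hL p hp hpL
  have hNN := image_eq _ (fun p hp => hp.1) _ (fun p hp => hp.1) hN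
  have hX : ∀ p ∈ vertices A, p ∈ extremeNookPoints A ↔ φ p ∈ extremeNookPoints B := by
    intro p hp
    refine and_congr (iff_of_true hp (hv p hp)) ?_
    rw [← hNN, exists_mem_image]
    refine exists_congr fun q => and_congr_right fun hq => ?_
    rw [hall]
    refine forall₂_congr fun L hL => ?_
    rw [h.mem_iff L hL p hp, h.mem_iff L hL q hq.1]
  refine ⟨hNN, image_eq _ (fun p hp => hp.1) _ (fun p hp => hp.1) fun p hp => ?_⟩
  refine and_congr (iff_of_true hp (hv p hp)) (not_congr ?_)
  exact or_congr (or_congr (hN p hp) (hX p hp)) (and_congr (hE p hp) (not_congr (hX p hp)))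

/-- An incidence isomorphism that preserves betweenness on the lines preserves nook points and
central pairs. -/
lemma preservesNookAndCentral (hσ : IsIncidenceIso A B φ σ) (hA : IsLineArrangement A)
    (hB : IsLineArrangement B)
    (hb : ∀ L ∈ A, ∀ p ∈ L, ∀ q ∈ L, ∀ r ∈ L, p ∈ vertices A → q ∈ vertices A → r ∈ vertices A →
      (Sbtw F q p r ↔ Sbtw F (φ q) (φ p) (φ r))) : PreservesNookAndCentral A B φ := by
  intro Q hQ h4
  have h3 : 3 ≤ A.ncard := by
    have := ncard_le_ncard hQ hA.finite
    omega
  rw [hσ.imageLines_eq hA hB h3 hQ]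
  refine (hσ.restrict hA hB hQ).image_nookPoints_and_centralPoints fun L hL p hp hpL => ?_
  have hQa := hA.subset hQ
  obtain ⟨M, hM, hML, rfl⟩ := hQa.exists_eq_meet hL hp hpL
  obtain ⟨N, hN, hN'⟩ := exists_mem_notMem_finset Q {L, M} (by
    rw [Finset.card_pair hML.symm]; omega)
  simp only [Finset.mem_insert, Finset.mem_singleton, not_or] at hN'
  obtain ⟨K, hK, hK'⟩ := exists_mem_notMem_finset Q {L, M, N} (by
    have := Finset.card_le_three (a := L) (b := M) (c := N); omega)
  simp only [Finset.mem_insert, Finset.mem_singleton, not_or] at hK'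
  have hLM := hML.symm
  have hLN := Ne.symm hN'.1
  have hLK := Ne.symm hK'.1
  have h : IsQuadruple Q L M N K := by
    have h := hQa.isQuadruple hL hM hN hK hLM hLN hLK (Ne.symm hN'.2)
      (Ne.symm hK'.2.1) (Ne.symm hK'.2.2)
    have hsub : ({L, M, N, K} : Set (Set (F × F))) ⊆ Q := by
      rintro _ (rfl | rfl | rfl | rfl) <;> assumption
    rwa [eq_of_subset_of_ncard_le hsub (by rw [h.ncard, h4]) hQa.finite] at h
  have h' := hσ.isQuadruple hB hQ h
  rw [← not_iff_not, hσ.apply_meet hA hB (hQ hL) (hQ hM) hLM, h.not_isOuterOn_iff,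
    h'.not_isOuterOn_iff, IsMid, IsMid, ← hσ.apply_meet hA hB (hQ hL) (hQ hM) hLM,
    ← hσ.apply_meet hA hB (hQ hL) (hQ hN) hLN, ← hσ.apply_meet hA hB (hQ hL) (hQ hK) hLK]
  exact hb L (hQ hL) _ (hQa.meet_mem_left hL hM hLM) _ (hQa.meet_mem_left hL hN hLN) _
    (hQa.meet_mem_left hL hK hLK) (hA.meet_mem_vertices (hQ hL) (hQ hM) hLM)
    (hA.meet_mem_vertices (hQ hL) (hQ hN) hLN) (hA.meet_mem_vertices (hQ hL) (hQ hK) hLK)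

end IsIncidenceIso

end NookAndCentral

/-! ### Piecewise linear bijections preserve betweenness on lines -/

section IntermediateValue

variable {F : Type*} [Field F] [LinearOrder F] [IsStrictOrderedRing F]

lemma exists_Icc_inter_halfline (a b : F) (k : F →ᵃ[F] F) :
    ∃ a' b' : F, Icc a b ∩ {t | k t ≤ 0} = Icc a' b' := by
  have hk : ∀ t, k t = t * k.linear 1 + k 0 := by
    intro t
    have h1 := k.map_vadd 0 t
    simp only [vadd_eq_add, add_zero] at h1
    rw [h1]
    congr 1
    rw [← smul_eq_mul, ← map_smul]; simp
  set α := k.linear 1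
  set β := k 0
  rcases lt_trichotomy α 0 with h | h | h
  · refine ⟨max a (-β / α), b, ?_⟩
    ext t
    have : k t ≤ 0 ↔ -β / α ≤ t := by
      rw [hk, div_le_iff_of_neg h]
      constructor <;> intro <;> linarith
    simp only [mem_inter_iff, mem_Icc, mem_ofPred_eq, this, max_le_iff]
    tauto
  · by_cases hβ : β ≤ 0
    · refine ⟨a, b, inter_eq_left.2 fun t _ => ?_⟩
      simp [hk, h, hβ]
    · refine ⟨1, 0, ?_⟩
      ext t
      simp only [mem_inter_iff, mem_ofPred_eq, hk, h, mul_zero, zero_add, hβ, and_false, mem_Icc,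
        false_iff, not_and]
      intro h1 h0
      exact absurd (h1.trans h0) (by simp)
  · refine ⟨a, min b (-β / α), ?_⟩
    ext t
    have : k t ≤ 0 ↔ t ≤ -β / α := by
      rw [hk, le_div_iff₀ h]
      constructor <;> intro <;> linarith
    simp only [mem_inter_iff, mem_Icc, mem_ofPred_eq, this, le_min_iff]
    tauto

lemma exists_isGreatest_sUnion {S : Set (Set F)} (hS : S.Finite)
    (hI : ∀ I ∈ S, ∃ a b : F, I = Icc a b) (hne : (⋃₀ S).Nonempty) :
    ∃ c, IsGreatest (⋃₀ S) c := by
  choose! a b hab using hI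
  obtain ⟨t, I, hI, ht⟩ := hne
  obtain ⟨J, ⟨hJ, ⟨s, hs⟩⟩, hmax⟩ := exists_max_image {I ∈ S | I.Nonempty} b (hS.subset
    fun I hI => hI.1) ⟨I, hI, t, ht⟩
  have hs' := (hab J hJ).le hs
  refine ⟨b J, ⟨J, hJ, (hab J hJ).ge ⟨hs'.1.trans hs'.2, le_rfl⟩⟩, ?_⟩
  · rintro u ⟨K, hK, hu⟩
    refine le_trans ?_ (hmax K ⟨hK, u, hu⟩)
    rw [hab K hK] at hu
    exact hu.2

lemma exists_isLeast_sUnion {S : Set (Set F)} (hS : S.Finite)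
    (hI : ∀ I ∈ S, ∃ a b : F, I = Icc a b) (hne : (⋃₀ S).Nonempty) :
    ∃ c, IsLeast (⋃₀ S) c := by
  choose! a b hab using hI
  obtain ⟨t, I, hI, ht⟩ := hne
  obtain ⟨J, ⟨hJ, ⟨s, hs⟩⟩, hmin⟩ := exists_min_image {I ∈ S | I.Nonempty} a (hS.subset
    fun I hI => hI.1) ⟨I, hI, t, ht⟩
  have hs' := (hab J hJ).le hs
  refine ⟨a J, ⟨J, hJ, (hab J hJ).ge ⟨le_rfl, hs'.1.trans hs'.2⟩⟩, ?_⟩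
  · rintro u ⟨K, hK, hu⟩
    refine le_trans (hmin K ⟨hK, u, hu⟩) ?_
    rw [hab K hK] at hu
    exact hu.1

/-- The intermediate value theorem for piecewise affine functions over an ordered field. The sets
`{g ≤ 0}` and `{g ≥ 0}` are finite unions of closed intervals, so that they have a largest and a
smallest element; no completeness of the field is needed. -/
theorem exists_eq_zero_of_piecewise_affine {S : Set (Set F)} (hS : S.Finite)
    (hcov : ⋃₀ S = Icc 0 1) (hI : ∀ I ∈ S, ∃ a b : F, I = Icc a b) {g : F → F}
    (hg : ∀ I ∈ S, ∃ k : F →ᵃ[F] F, EqOn g k I) (h0 : g 0 ≤ 0) (h1 : 0 ≤ g 1) :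
    ∃ t ∈ Icc (0 : F) 1, g t = 0 := by
  choose! a b hab using hI
  choose! k hk using hg
  have hsub : ∀ {I t}, I ∈ S → t ∈ I → t ∈ Icc (0 : F) 1 := fun hI ht =>
    hcov ▸ mem_sUnion_of_mem ht hI
  have hU : ⋃₀ ((fun I => I ∩ {t | k I t ≤ 0}) '' S) = {t ∈ Icc (0 : F) 1 | g t ≤ 0} := by
    ext t
    constructor
    · rintro ⟨_, ⟨I, hI, rfl⟩, ht, ht'⟩
      exact ⟨hsub hI ht, (hk I hI ht).trans_le ht'⟩
    · rintro ⟨ht, ht'⟩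
      rw [← hcov] at ht
      obtain ⟨I, hI, ht⟩ := ht
      exact ⟨_, mem_image_of_mem _ hI, ht, (hk I hI ht).symm.trans_le ht'⟩
  obtain ⟨u, ⟨hu, hgu⟩, hmax⟩ := exists_isGreatest_sUnion (hS.image _) (by
    rintro _ ⟨I, hI, rfl⟩
    simp only
    nth_rewrite 1 [hab I hI]
    exact exists_Icc_inter_halfline _ _ _) (hU ▸ ⟨0, by simp, h0⟩)|>.imp fun u hu => hU ▸ hu
  rcases hgu.eq_or_lt with h | hlt
  · exact ⟨u, hu, h⟩
  exfalso
  -- beyond `u` the function is positive; let `v` be the first point there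
  have hV : ⋃₀ ((fun I => (I ∩ {t | (-k I) t ≤ 0}) ∩ {t | (AffineMap.const F F u - AffineMap.id F F
      : F →ᵃ[F] F) t ≤ 0}) '' S) = {t ∈ Icc (0 : F) 1 | 0 ≤ g t ∧ u ≤ t} := by
    ext t
    constructor
    · rintro ⟨_, ⟨I, hI, rfl⟩, ⟨ht, ht'⟩, hut⟩
      refine ⟨hsub hI ht, ?_, by simpa using hut⟩
      rw [hk I hI ht]
      simpa using ht'
    · rintro ⟨ht, ht', hut⟩
      rw [← hcov] at ht
      obtain ⟨I, hI, ht⟩ := ht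
      refine ⟨_, mem_image_of_mem _ hI, ⟨ht, ?_⟩, by simpa using hut⟩
      rw [hk I hI ht] at ht'
      simpa using ht'
  obtain ⟨v, ⟨hv, hgv, huv⟩, hmin⟩ := exists_isLeast_sUnion (hS.image _) (by
    rintro _ ⟨I, hI, rfl⟩
    simp only
    nth_rewrite 1 [hab I hI]
    obtain ⟨a', b', h⟩ := exists_Icc_inter_halfline (a I) (b I) (-k I)
    rw [h]
    exact exists_Icc_inter_halfline _ _ _) (hV ▸ ⟨1, by simp, h1, hu.2⟩)|>.imp fun u hu => hV ▸ hu
  have huv' : u < v := lt_of_le_of_ne huv fun h => by rw [h] at hlt; exact hlt.not_ge hgv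
  have hm1 : u < (u + v) / 2 := by linarith
  have hm2 : (u + v) / 2 < v := by linarith
  have hm : (u + v) / 2 ∈ Icc (0 : F) 1 := ⟨by linarith [hu.1], by linarith [hv.2]⟩
  rcases le_total (g ((u + v) / 2)) 0 with h | h
  · exact hm1.not_ge (hmax ⟨hm, h⟩)
  · exact hm2.not_ge (hmin ⟨hm, h, hm1.le⟩)

lemma IsPolyhedron.exists_Icc {C : Set (F × F)} (hC : IsPolyhedron C) (p q : F × F) :
    ∃ a b : F, {t ∈ Icc (0 : F) 1 | AffineMap.lineMap p q t ∈ C} = Icc a b := by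
  classical
  obtain ⟨H, rfl⟩ := hC
  induction H using Finset.induction_on with
  | empty => exact ⟨0, 1, by ext; simp⟩
  | insert h H _ ih =>
    obtain ⟨a, b, hab⟩ := ih
    obtain ⟨a', b', hab'⟩ := exists_Icc_inter_halfline a b
      (((h.1 • LinearMap.fst F F F + h.2.1 • LinearMap.snd F F F).toAffineMap -
        AffineMap.const F _ h.2.2).comp (AffineMap.lineMap p q))
    refine ⟨a', b', ?_⟩
    rw [← hab', ← hab]
    ext t
    simp only [Finset.mem_insert, forall_eq_or_imp, mem_ofPred_eq, mem_inter_iff]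
    have : h.1 * (AffineMap.lineMap p q t : F × F).1 + h.2.1 * (AffineMap.lineMap p q t : F × F).2
        ≤ h.2.2 ↔ (((h.1 • LinearMap.fst F F F + h.2.1 • LinearMap.snd F F F).toAffineMap -
        AffineMap.const F _ h.2.2).comp (AffineMap.lineMap p q) : F →ᵃ[F] F) t ≤ 0 := by
      rw [AffineMap.comp_apply]
      generalize AffineMap.lineMap p q t = x
      simp
    rw [this]
    tauto

lemma IsPiecewiseLinear.exists_eq_zero {f : F × F → F × F} (hf : IsPiecewiseLinear f)
    (e : (F × F) →ᵃ[F] F) {p q : F × F} (h : e (f p) * e (f q) < 0) :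
    ∃ t ∈ Icc (0 : F) 1, e (f (AffineMap.lineMap p q t)) = 0 := by
  have key : ∀ e : (F × F) →ᵃ[F] F, e (f p) ≤ 0 → 0 ≤ e (f q) →
      ∃ t ∈ Icc (0 : F) 1, e (f (AffineMap.lineMap p q t)) = 0 := by
    intro e h0 h1
    obtain ⟨S, hS, hcov, hC⟩ := hf
    refine exists_eq_zero_of_piecewise_affine
      (S := (fun C => {t ∈ Icc (0 : F) 1 | AffineMap.lineMap p q t ∈ C}) '' S)
      (g := fun t => e (f (AffineMap.lineMap p q t))) (hS.image _) ?_ ?_ ?_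
      (by simpa using h0) (by simpa using h1)
    · ext t
      constructor
      · rintro ⟨_, ⟨C, hC, rfl⟩, ht, -⟩
        exact ht
      · intro ht
        have : AffineMap.lineMap p q t ∈ ⋃₀ S := hcov ▸ mem_univ _
        obtain ⟨C, hC, htC⟩ := this
        exact ⟨_, mem_image_of_mem _ hC, ht, htC⟩
    · rintro _ ⟨C, hCS, rfl⟩
      exact (hC C hCS).1.exists_Icc p q
    · rintro _ ⟨C, hCS, rfl⟩
      obtain ⟨-, G, hG⟩ := hC C hCS
      refine ⟨(e.comp G).comp (AffineMap.lineMap p q), fun t ht => ?_⟩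
      simp [hG ht.2]
  rcases mul_neg_iff.1 h with ⟨h1, h2⟩ | ⟨h1, h2⟩
  · obtain ⟨t, ht, h⟩ := key (-e) (by simpa using h1.le) (by simpa using h2.le)
    exact ⟨t, ht, by simpa using h⟩
  · exact key e h1.le h2.le

/-- An injective piecewise linear map that takes a line into a line preserves betweenness on that
line: by the intermediate value theorem, a point whose image is between the images of two others
is between these. -/
lemma IsPiecewiseLinear.sbtw {f : F × F → F × F} (hf : IsPiecewiseLinear f)
    (hinj : Function.Injective f) {L M : Set (F × F)} (hL : IsLine L) (hM : IsLine M)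
    (hLM : MapsTo f L M) {p q r : F × F} (hp : p ∈ L) (hq : q ∈ L) (hr : r ∈ L)
    (h : Sbtw F q p r) : Sbtw F (f q) (f p) (f r) := by
  have key : ∀ {x y z : F × F}, x ∈ L → y ∈ L → z ∈ L → x ≠ y →
      Sbtw F (f x) (f y) (f z) → Wbtw F x y z := by
    intro x y z hx hy hz hxy hs
    have hne : f x ≠ f y := fun h => hxy (hinj h)
    obtain ⟨e, he, hex⟩ : ∃ e : (F × F) →ᵃ[F] F, e (f y) = 0 ∧ e (f x) ≠ 0 := by
      by_cases h1 : (f x).1 = (f y).1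
      · refine ⟨(LinearMap.snd F F F).toAffineMap - AffineMap.const F _ (f y).2, by simp, ?_⟩
        simpa [sub_eq_zero] using fun h2 => hne (Prod.ext h1 h2)
      · exact ⟨(LinearMap.fst F F F).toAffineMap - AffineMap.const F _ (f y).1, by simp, by
          simpa [sub_eq_zero] using h1⟩
    have hneg := (hM.sbtw_iff_mul_neg (hLM hy) (hLM hx) (hLM hz) e he hex).1 hs
    obtain ⟨t, ht, h0⟩ := hf.exists_eq_zero e hneg
    have hfy : f (AffineMap.lineMap x z t) = f y := by
      obtain ⟨s, hs⟩ := hM.eq_lineMap (hLM hy) (hLM hx) hne.symm (hLM (hL.lineMap_mem hx hz t))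
      rw [hs, AffineMap.apply_lineMap, he, AffineMap.lineMap_apply] at h0
      have : s = 0 := by simpa [hex] using h0
      rw [hs, this, AffineMap.lineMap_apply_zero]
    exact ⟨t, ht, hinj hfy⟩
  have hqp : q ≠ p := h.2.1.symm
  have hpr : p ≠ r := h.2.2
  have hqr : q ≠ r := h.left_ne_right
  rcases hM.sbtw_or_sbtw_or_sbtw (hLM hp) (hLM hq) (hLM hr) (hinj.ne hqp.symm) (hinj.ne hpr)
    (hinj.ne hqr) with h1 | h1 | h1
  · exact h1
  · exact absurd ⟨key hp hq hr hqp.symm h1, hqp, hqr⟩ (not_sbtw_of_sbtw h)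
  · exact absurd ⟨key hp hr hq hpr h1, hpr.symm, hqr.symm⟩ (not_sbtw_of_sbtw h.symm)

end IntermediateValue

/-! ### Isomorphisms of arrangements preserve nook points and central pairs -/

section Converse

variable {F : Type*} [Field F] [LinearOrder F] [IsStrictOrderedRing F]
  {A B : Set (Set (F × F))} {φ : F × F → F × F}

lemma IsIncidenceIso.isCollineationIso {σ : Set (F × F) → Set (F × F)}
    (h : IsIncidenceIso A B φ σ) : IsCollineationIso A B φ := by
  refine ⟨h.bijOn, ?_⟩
  rintro p hp q hq r hr - - - ⟨L, hL, hpL, hqL, hrL⟩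
  exact ⟨σ L, h.bijOn_lines.mapsTo hL, (h.mem_iff L hL p hp).2 hpL, (h.mem_iff L hL q hq).2 hqL,
    (h.mem_iff L hL r hr).2 hrL⟩

lemma isIncidenceIso_of_equiv (f : (F × F) ≃ (F × F)) (hf : (fun L => f '' L) '' A = B)
    (hφ : EqOn φ f (vertices A)) : IsIncidenceIso A B φ (fun L => f '' L) := by
  subst hf
  refine ⟨⟨mapsTo_image _ _, (image_injective.2 f.injective).injOn, surjOn_image _ _⟩,
    BijOn.congr ⟨?_, f.injective.injOn, ?_⟩ hφ.symm, fun L hL p hp => ?_⟩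
  · rintro p ⟨L, hL, M, hM, hLM, hpL, hpM⟩
    exact ⟨_, mem_image_of_mem _ hL, _, mem_image_of_mem _ hM,
      (image_injective.2 f.injective).ne hLM, mem_image_of_mem f hpL, mem_image_of_mem f hpM⟩
  · rintro _ ⟨_, ⟨L, hL, rfl⟩, _, ⟨M, hM, rfl⟩, hLM, ⟨p, hpL, rfl⟩, hpM⟩
    exact ⟨p, ⟨L, hL, M, hM, fun h => hLM (h ▸ rfl), hpL,
      (f.injective.mem_set_image).1 hpM⟩, rfl⟩
  · rw [hφ hp]
    exact f.injective.mem_set_image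

/-- An isomorphism of line arrangements is a collineation isomorphism that preserves nook points
and central pairs. -/
theorem IsArrangementIso.isCollineationIso_and_preserves (hA : IsLineArrangement A)
    (hB : IsLineArrangement B) (h : IsArrangementIso A B φ) :
    IsCollineationIso A B φ ∧ PreservesNookAndCentral A B φ := by
  obtain ⟨f, hf, hf', hAB, hφ⟩ := h
  have hσ := isIncidenceIso_of_equiv f hAB hφ
  refine ⟨hσ.isCollineationIso, hσ.preservesNookAndCentral hA hB ?_⟩
  intro L hL p hp q hq r hr hpv hqv hrv
  have hL' := hA.isLine L hL
  have hM' := hB.isLine _ (hσ.bijOn_lines.mapsTo hL)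
  rw [hφ hpv, hφ hqv, hφ hrv]
  refine ⟨hf.sbtw f.injective hL' hM' (mapsTo_image f L) hp hq hr, fun h => ?_⟩
  have hmaps : MapsTo f.symm (f '' L) L := by
    rintro _ ⟨x, hx, rfl⟩; simpa using hx
  simpa using hf'.sbtw f.symm.injective hM' hL' hmaps (mem_image_of_mem f hp)
    (mem_image_of_mem f hq) (mem_image_of_mem f hr) h

end Converse

/-! ### From betweenness to sign vectors -/

section Labelled

variable {F : Type*} [Field F] [LinearOrder F] [IsStrictOrderedRing F]
  {Λ : Type*} {P P' : Λ → Set (F × F)}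

/-- A line arrangement whose lines are labelled by `Λ`. -/
structure IsLabelledArrangement (P : Λ → Set (F × F)) : Prop where
  arr : IsLineArrangement (range P)
  inj : Function.Injective P

/-- Two arrangements labelled by the same type have the same betweenness relations on their
lines. -/
def SameBetweenness (P P' : Λ → Set (F × F)) : Prop :=
  ∀ i j k l, i ≠ j → i ≠ k → i ≠ l → j ≠ k → j ≠ l → k ≠ l →
    (IsMid (P i) (P j) (P k) (P l) ↔ IsMid (P' i) (P' j) (P' k) (P' l))

lemma SameBetweenness.symm (h : SameBetweenness P P') : SameBetweenness P' P :=
  fun i j k l h1 h2 h3 h4 h5 h6 => (h i j k l h1 h2 h3 h4 h5 h6).symm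

namespace IsLabelledArrangement

lemma isLine (h : IsLabelledArrangement P) (i : Λ) : IsLine (P i) :=
  h.arr.isLine _ (mem_range_self i)

lemma isQuadruple (h : IsLabelledArrangement P) {i j k l : Λ} (h1 : i ≠ j) (h2 : i ≠ k)
    (h3 : i ≠ l) (h4 : j ≠ k) (h5 : j ≠ l) (h6 : k ≠ l) :
    IsQuadruple {P i, P j, P k, P l} (P i) (P j) (P k) (P l) :=
  h.arr.isQuadruple (mem_range_self i) (mem_range_self j) (mem_range_self k) (mem_range_self l)
    (h.inj.ne h1) (h.inj.ne h2) (h.inj.ne h3) (h.inj.ne h4) (h.inj.ne h5) (h.inj.ne h6)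

lemma meet_mem_left (h : IsLabelledArrangement P) {i j : Λ} (hij : i ≠ j) :
    meet (P i) (P j) ∈ P i :=
  h.arr.meet_mem_left (mem_range_self i) (mem_range_self j) (h.inj.ne hij)

lemma meet_mem_right (h : IsLabelledArrangement P) {i j : Λ} (hij : i ≠ j) :
    meet (P i) (P j) ∈ P j :=
  h.arr.meet_mem_right (mem_range_self i) (mem_range_self j) (h.inj.ne hij)

lemma meet_notMem (h : IsLabelledArrangement P) {i j k : Λ} (hij : i ≠ j) (hik : i ≠ k)
    (hjk : j ≠ k) : meet (P i) (P j) ∉ P k :=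
  h.arr.meet_notMem (mem_range_self i) (mem_range_self j) (mem_range_self k) (h.inj.ne hij)
    (h.inj.ne hik) (h.inj.ne hjk)

lemma eq_meet (h : IsLabelledArrangement P) {i j : Λ} (hij : i ≠ j) {p : F × F} (hi : p ∈ P i)
    (hj : p ∈ P j) : p = meet (P i) (P j) :=
  h.arr.eq_meet (mem_range_self i) (mem_range_self j) (h.inj.ne hij) hi hj

variable {e e' : (F × F) →ᵃ[F] F} {k : Λ}

lemma apply_ne_zero (h : IsLabelledArrangement P) (he : ∀ p, p ∈ P k ↔ e p = 0) {i j : Λ}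
    (hij : i ≠ j) (hik : i ≠ k) (hjk : j ≠ k) : e (meet (P i) (P j)) ≠ 0 :=
  fun h0 => h.meet_notMem hij hik hjk ((he _).2 h0)

lemma sign_mul_sign_of_isMid_iff (h : IsLabelledArrangement P) (h' : IsLabelledArrangement P')
    (hb : SameBetweenness P P') (he : ∀ p, p ∈ P k ↔ e p = 0) (he' : ∀ p, p ∈ P' k ↔ e' p = 0)
    {i j l : Λ} (hij : i ≠ j) (hik : i ≠ k) (hjk : j ≠ k) (hil : i ≠ l) (hlk : l ≠ k) :
    SignType.sign (e (meet (P i) (P j))) * SignType.sign (e (meet (P i) (P l))) =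
      SignType.sign (e' (meet (P' i) (P' j))) * SignType.sign (e' (meet (P' i) (P' l))) := by
  have n1 := h.apply_ne_zero he hij hik hjk
  have n2 := h'.apply_ne_zero he' hij hik hjk
  have n3 := h.apply_ne_zero he hil hik hlk
  have n4 := h'.apply_ne_zero he' hil hik hlk
  simp only [← sign_mul]
  by_cases hjl : j = l
  · subst hjl
    rw [sign_pos (mul_self_pos.2 n1), sign_pos (mul_self_pos.2 n2)]
  have hm := hb i k j l hik hij hil hjk.symm hlk.symm hjl
  rw [(h.isQuadruple hik hij hil hjk.symm hlk.symm hjl).isMid_iff_mul_neg he,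
    (h'.isQuadruple hik hij hil hjk.symm hlk.symm hjl).isMid_iff_mul_neg he'] at hm
  rcases lt_or_gt_of_ne (mul_ne_zero n1 n3) with hlt | hgt
  · rw [sign_neg hlt, sign_neg (hm.1 hlt)]
  · rw [sign_pos hgt, sign_pos (lt_of_le_of_ne (not_lt.1 fun h0 => hgt.not_gt (hm.2 h0))
      (mul_ne_zero n2 n4).symm)]

/-- Whether two intersection points lie on the same side of a third line is determined by the
betweenness relations: two points that are on no common line are compared through a third. -/
lemma sign_mul_sign (h : IsLabelledArrangement P) (h' : IsLabelledArrangement P')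
    (hb : SameBetweenness P P') (he : ∀ p, p ∈ P k ↔ e p = 0) (he' : ∀ p, p ∈ P' k ↔ e' p = 0)
    {i j i' j' : Λ} (hij : i ≠ j) (hik : i ≠ k) (hjk : j ≠ k) (hij' : i' ≠ j') (hik' : i' ≠ k)
    (hjk' : j' ≠ k) :
    SignType.sign (e (meet (P i) (P j))) * SignType.sign (e (meet (P i') (P j'))) =
      SignType.sign (e' (meet (P' i) (P' j))) * SignType.sign (e' (meet (P' i') (P' j'))) := by
  by_cases hii : i = i'
  · subst hii
    exact h.sign_mul_sign_of_isMid_iff h' hb he he' hij hik hjk hij' hjk'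
  have h1 := h.sign_mul_sign_of_isMid_iff h' hb he he' hij hik hjk hii hik'
  have h2 := h.sign_mul_sign_of_isMid_iff h' hb he he' (Ne.symm hii) hik' hik hij' hjk'
  rw [meet_comm (P i') (P i), meet_comm (P' i') (P' i)] at h2
  have n1 := sign_ne_zero.2 (h.apply_ne_zero he hii hik hik')
  have n2 := sign_ne_zero.2 (h'.apply_ne_zero he' hii hik hik')
  revert h1 h2 n1 n2
  generalize SignType.sign (e (meet (P i) (P j))) = a
  generalize SignType.sign (e (meet (P i) (P i'))) = b
  generalize SignType.sign (e (meet (P i') (P j'))) = c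
  generalize SignType.sign (e' (meet (P' i) (P' j))) = a'
  generalize SignType.sign (e' (meet (P' i) (P' i'))) = b'
  generalize SignType.sign (e' (meet (P' i') (P' j'))) = c'
  intro h1 h2 n1 n2
  have hsq : ∀ s : SignType, s ≠ 0 → s * s = 1 := by decide
  have hbb := hsq b n1
  have hbb' := hsq b' n2
  calc a * c = (a * b) * (b * c) := by rw [mul_assoc, ← mul_assoc b, hbb, one_mul]
    _ = (a' * b') * (b' * c') := by rw [h1, h2]
    _ = a' * c' := by rw [mul_assoc, ← mul_assoc b', hbb', one_mul]

/-- Corresponding lines can be oriented such that corresponding intersection points are on the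
same side. -/
lemma exists_forms (h : IsLabelledArrangement P) (h' : IsLabelledArrangement P')
    (hb : SameBetweenness P P') (h3 : ∀ k : Λ, ∃ i j, i ≠ j ∧ i ≠ k ∧ j ≠ k) (k : Λ) :
    ∃ e e' : (F × F) →ᵃ[F] F, (∀ p, p ∈ P k ↔ e p = 0) ∧ (∀ p, p ∈ P' k ↔ e' p = 0) ∧
      ∀ i j, i ≠ j → SignType.sign (e (meet (P i) (P j))) =
        SignType.sign (e' (meet (P' i) (P' j))) := by
  obtain ⟨e, he⟩ := (h.isLine k).exists_affineMap
  obtain ⟨e₀, he₀⟩ := (h'.isLine k).exists_affineMap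
  obtain ⟨i₀, j₀, hij, hik, hjk⟩ := h3 k
  have main : ∀ e' : (F × F) →ᵃ[F] F, (∀ p, p ∈ P' k ↔ e' p = 0) →
      SignType.sign (e (meet (P i₀) (P j₀))) = SignType.sign (e' (meet (P' i₀) (P' j₀))) →
      ∀ i j, i ≠ j → SignType.sign (e (meet (P i) (P j))) =
        SignType.sign (e' (meet (P' i) (P' j))) := by
    intro e' he' hs i j hij'
    by_cases hi : i = k
    · subst hi
      rw [(he _).1 (h.meet_mem_left hij'), (he' _).1 (h'.meet_mem_left hij')]
    by_cases hj : j = k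
    · subst hj
      rw [(he _).1 (h.meet_mem_right hij'), (he' _).1 (h'.meet_mem_right hij')]
    have h1 := h.sign_mul_sign h' hb he he' hij' hi hj hij hik hjk
    have n1 := sign_ne_zero.2 (h.apply_ne_zero he hij hik hjk)
    rw [← hs] at h1
    revert h1 n1
    generalize SignType.sign (e (meet (P i) (P j))) = a
    generalize SignType.sign (e (meet (P i₀) (P j₀))) = b
    generalize SignType.sign (e' (meet (P' i) (P' j))) = c
    revert a b c
    decide
  by_cases hs : SignType.sign (e (meet (P i₀) (P j₀))) =
      SignType.sign (e₀ (meet (P' i₀) (P' j₀)))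
  · exact ⟨e, e₀, he, he₀, main e₀ he₀ hs⟩
  · have he₁ : ∀ p, p ∈ P' k ↔ (-e₀) p = 0 := fun p => by simp [he₀]
    refine ⟨e, -e₀, he, he₁, main _ he₁ ?_⟩
    have n1 := sign_ne_zero.2 (h.apply_ne_zero he hij hik hjk)
    have n2 := sign_ne_zero.2 (h'.apply_ne_zero he₀ hij hik hjk)
    change _ = SignType.sign (-(e₀ _))
    rw [Left.sign_neg]
    revert hs n1 n2
    generalize SignType.sign (e (meet (P i₀) (P j₀))) = a
    generalize SignType.sign (e₀ (meet (P' i₀) (P' j₀))) = b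
    revert a b
    decide

end IsLabelledArrangement

/-- The linear form on `F² × F` that restricts to the given affine function on the plane at
height `1`. -/
def homogenize (e : (F × F) →ᵃ[F] F) : (F × F) × F →ₗ[F] F :=
  e.linear.comp (LinearMap.fst F (F × F) F) + e 0 • LinearMap.snd F (F × F) F

lemma homogenize_one (e : (F × F) →ᵃ[F] F) (p : F × F) : homogenize e (p, 1) = e p := by
  have h1 := e.map_vadd 0 p
  simp only [vadd_eq_add, add_zero] at h1
  simp [homogenize, h1]

lemma homogenize_zero (e : (F × F) →ᵃ[F] F) (d : F × F) : homogenize e (d, 0) = e.linear d := by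
  simp [homogenize]

/-- The family of linear forms on `F² × F` that belongs to a family of lines in the plane at
height `1`, together with the height as the form of the line at infinity. -/
def coneForms (e : Λ → (F × F) →ᵃ[F] F) : Option Λ → (F × F) × F →ₗ[F] F
  | none => LinearMap.snd F (F × F) F
  | some i => homogenize (e i)

lemma sign_sub_of_mul_neg {a b : F} (h : a * b < 0) :
    SignType.sign (b - a) = SignType.sign b := by
  rcases mul_neg_iff.1 h with ⟨ha, hb⟩ | ⟨ha, hb⟩
  · rw [sign_neg hb, sign_neg (by linarith)]
  · rw [sign_pos hb, sign_pos (by linarith)]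

lemma sign_sub_of_eq_mul {a b t : F} (ht : t < 1) (h : a = t * b) :
    SignType.sign (b - a) = SignType.sign b := by
  have : b - a = (1 - t) * b := by rw [h]; ring
  rw [this, sign_mul, sign_pos (sub_pos.2 ht), one_mul]

namespace IsLabelledArrangement

variable {e e' : Λ → (F × F) →ᵃ[F] F}

lemma coneForms_pointed [Nontrivial Λ] (h : IsLabelledArrangement P)
    (he : ∀ k p, p ∈ P k ↔ e k p = 0) (x : (F × F) × F) (hx : ∀ i, coneForms e i x = 0) :
    x = 0 := by
  obtain ⟨d, z⟩ := x
  obtain rfl : z = 0 := hx none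
  obtain ⟨i, j, hij⟩ := exists_pair_ne Λ
  have hmem : ∀ k, meet (P i) (P j) ∈ P k → meet (P i) (P j) + d ∈ P k := by
    intro k hk
    have h0 : homogenize (e k) (d, 0) = 0 := hx (some k)
    rw [he] at hk ⊢
    have h1 := (e k).map_vadd (meet (P i) (P j)) d
    simp only [vadd_eq_add] at h1
    rw [add_comm, h1, hk, ← homogenize_zero, h0, add_zero]
  have := h.eq_meet hij (hmem i (h.meet_mem_left hij)) (hmem j (h.meet_mem_right hij))
  simpa using this

/-- The sign of a linear form along a line, in the direction from one intersection point to
another, is determined by signs of the form at these points and betweenness. -/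
lemma sign_sub_eq (h : IsLabelledArrangement P) (h' : IsLabelledArrangement P')
    (hb : SameBetweenness P P') (he : ∀ k p, p ∈ P k ↔ e k p = 0)
    (he' : ∀ k p, p ∈ P' k ↔ e' k p = 0)
    (hs : ∀ k i j, i ≠ j → SignType.sign (e k (meet (P i) (P j))) =
      SignType.sign (e' k (meet (P' i) (P' j)))) {i j l : Λ} (hij : i ≠ j) (hil : i ≠ l)
    (hjl : j ≠ l) (k : Λ) :
    SignType.sign (e k (meet (P i) (P l)) - e k (meet (P i) (P j))) =
      SignType.sign (e' k (meet (P' i) (P' l)) - e' k (meet (P' i) (P' j))) := by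
  by_cases hki : k = i
  · subst hki
    rw [(he k _).1 (h.meet_mem_left hij), (he k _).1 (h.meet_mem_left hil),
      (he' k _).1 (h'.meet_mem_left hij), (he' k _).1 (h'.meet_mem_left hil)]
  by_cases hkj : k = j
  · subst hkj
    rw [(he k _).1 (h.meet_mem_right hij), (he' k _).1 (h'.meet_mem_right hij), sub_zero, sub_zero,
      hs k i l hil]
  by_cases hkl : k = l
  · subst hkl
    rw [(he k _).1 (h.meet_mem_right hil), (he' k _).1 (h'.meet_mem_right hil), zero_sub, zero_sub,
      Left.sign_neg, Left.sign_neg, hs k i j hij]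
  have hik := Ne.symm hki
  have q := h.isQuadruple hik hij hil hkj hkl hjl
  have q' := h'.isQuadruple hik hij hil hkj hkl hjl
  have z := (he k _).1 (h.meet_mem_right hik)
  have z' := (he' k _).1 (h'.meet_mem_right hik)
  rcases q.isMid_or with hm | hm | hm
  · have hm' := (hb i k j l hik hij hil hkj hkl hjl).1 hm
    rw [q.isMid_iff_mul_neg (he k)] at hm
    rw [q'.isMid_iff_mul_neg (he' k)] at hm'
    rw [sign_sub_of_mul_neg hm, sign_sub_of_mul_neg hm', hs k i l hil]
  · have hm' := (hb i j k l hij hik hil (Ne.symm hkj) hjl hkl).1 hm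
    obtain ⟨t, -, ht, e1⟩ := apply_of_sbtw _ z hm
    obtain ⟨t', -, ht', e1'⟩ := apply_of_sbtw _ z' hm'
    rw [sign_sub_of_eq_mul ht e1, sign_sub_of_eq_mul ht' e1', hs k i l hil]
  · have hm' := (hb i l k j hil hik hij (Ne.symm hkl) hjl.symm hkj).1 hm
    obtain ⟨t, -, ht, e1⟩ := apply_of_sbtw _ z hm
    obtain ⟨t', -, ht', e1'⟩ := apply_of_sbtw _ z' hm'
    rw [← neg_sub, ← neg_sub (e' k _), Left.sign_neg, Left.sign_neg, sign_sub_of_eq_mul ht e1,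
      sign_sub_of_eq_mul ht' e1', hs k i j hij]

/-- The fans of two labelled arrangements with the same betweenness relations have the same sign
vectors. By `exists_signVector_eq` it is enough to consider the multiples of intersection points,
and of the directions of the lines. -/
lemma exists_signVector_eq [Finite Λ] (h : IsLabelledArrangement P)
    (h' : IsLabelledArrangement P') (hb : SameBetweenness P P')
    (h3 : ∀ k : Λ, ∃ i j, i ≠ j ∧ i ≠ k ∧ j ≠ k)
    (he : ∀ k p, p ∈ P k ↔ e k p = 0) (he' : ∀ k p, p ∈ P' k ↔ e' k p = 0)
    (hs : ∀ k i j, i ≠ j → SignType.sign (e k (meet (P i) (P j))) =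
      SignType.sign (e' k (meet (P' i) (P' j)))) (x : (F × F) × F)
    [Nontrivial Λ] : ∃ x', signVector (coneForms e') x' = signVector (coneForms e) x := by
  have hdir : ∀ (d : F × F) (i : Λ), homogenize (e i) (d, 0) = 0 →
      ∃ x', signVector (coneForms e') x' = signVector (coneForms e) (d, 0) := by
    intro d i hd
    obtain ⟨j, l, hjl, hji, hli⟩ := h3 i
    have hij := Ne.symm hji
    have hil := Ne.symm hli
    have hne : meet (P i) (P l) - meet (P i) (P j) ≠ 0 := fun h0 =>
      h.meet_notMem hil hij hjl.symm (by
        rw [sub_eq_zero.1 h0]; exact h.meet_mem_right hij)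
    obtain ⟨c, hc⟩ := (h.isLine i).exists_smul (q := meet (P i) (P j) + d) (h.meet_mem_left hij)
      hne (by rw [add_sub_cancel]; exact h.meet_mem_left hil) (by
        rw [homogenize_zero] at hd
        have h1 := (e i).map_vadd (meet (P i) (P j)) d
        simp only [vadd_eq_add] at h1
        rw [he, add_comm, h1, hd, (he i _).1 (h.meet_mem_left hij), add_zero])
    have hc' : d = c • (meet (P i) (P l) - meet (P i) (P j)) := add_left_cancel hc
    refine ⟨(c • (meet (P' i) (P' l) - meet (P' i) (P' j)), 0), funext fun k => ?_⟩
    rcases k with _ | k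
    · simp [signVector, coneForms]
    · have e1 := (e k).linearMap_vsub (meet (P i) (P l)) (meet (P i) (P j))
      have e2 := (e' k).linearMap_vsub (meet (P' i) (P' l)) (meet (P' i) (P' j))
      simp only [vsub_eq_sub] at e1 e2
      simp only [signVector, coneForms, homogenize_zero]
      rw [hc', LinearMap.map_smul, LinearMap.map_smul, e1, e2, smul_eq_mul, smul_eq_mul, sign_mul, sign_mul,
        h.sign_sub_eq h' hb he he' hs hij hil hjl k]
  refine LineArr.exists_signVector_eq (by simp) (h.coneForms_pointed he) ?_ x
  rintro ⟨d, z⟩ i j hij hi hj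
  by_cases hz : z = 0
  · subst hz
    rcases i with _ | i
    · rcases j with _ | j
      · exact absurd rfl hij
      · exact hdir d j hj
    · exact hdir d i hi
  rcases i with _ | i
  · exact absurd hi hz
  rcases j with _ | j
  · exact absurd hj hz
  have hij' : i ≠ j := fun h0 => hij (h0 ▸ rfl)
  have hx : ((d, z) : (F × F) × F) = z • (z⁻¹ • d, 1) := by
    simp [smul_smul, mul_inv_cancel₀ hz]
  have hmem : ∀ k, coneForms e (some k) (d, z) = 0 → z⁻¹ • d ∈ P k := by
    intro k hk
    rw [hx, map_smul, smul_eq_mul, mul_eq_zero] at hk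
    rw [he, ← homogenize_one]
    exact hk.resolve_left hz
  refine ⟨z • (meet (P' i) (P' j), 1), funext fun k => ?_⟩
  rw [hx, h.eq_meet hij' (hmem i hi) (hmem j hj)]
  simp only [signVector, map_smul, smul_eq_mul, sign_mul]
  congr 1
  rcases k with _ | k
  · simp [coneForms]
  · simp only [coneForms, homogenize_one]
    exact (hs k i j hij').symm

end IsLabelledArrangement

/-- A map of `F² × F` that preserves the height and is linear on finitely many polyhedral cones
that cover the space is piecewise linear on the plane at height `1`. -/
lemma isPiecewiseLinear_of_cones {f : (F × F) × F → (F × F) × F}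
    (hf : ∃ 𝒞 : Set (Set ((F × F) × F)), 𝒞.Finite ∧ ⋃₀ 𝒞 = univ ∧ ∀ C ∈ 𝒞,
      IsPolyhedralCone (F := F) C ∧ ∃ g : (F × F) × F →ₗ[F] (F × F) × F, EqOn f g C) :
    IsPiecewiseLinear (fun p => (f (p, 1)).1) := by
  obtain ⟨𝒞, hfin, hcov, hC⟩ := hf
  refine ⟨(fun C => {p | (p, 1) ∈ C}) '' 𝒞, hfin.image _, eq_univ_of_forall fun p => ?_, ?_⟩
  · obtain ⟨C, hC, hpC⟩ : ((p, 1) : (F × F) × F) ∈ ⋃₀ 𝒞 := hcov ▸ mem_univ _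
    exact ⟨_, mem_image_of_mem _ hC, hpC⟩
  · rintro _ ⟨C, hCm, rfl⟩
    obtain ⟨⟨H, hH, rfl⟩, g, hg⟩ := hC C hCm
    constructor
    · classical
      refine ⟨hH.toFinset.image fun h => (h ((1, 0), 0), h ((0, 1), 0), -h ((0, 0), 1)), ?_⟩
      ext p
      simp only [mem_ofPred_eq, Finset.forall_mem_image, Finite.mem_toFinset]
      refine forall₂_congr fun h _ => ?_
      have : ((p, 1) : (F × F) × F) =
          p.1 • ((1, 0), 0) + p.2 • ((0, 1), 0) + ((0, 0), 1) := by
        ext <;> simp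
      rw [this, map_add, map_add, map_smul, map_smul, smul_eq_mul, smul_eq_mul]
      constructor <;> intro <;> linarith
    · refine ⟨((LinearMap.fst F (F × F) F).comp
        (g.comp (LinearMap.inl F (F × F) F))).toAffineMap +
        AffineMap.const F (F × F) (g (0, 1)).1, fun p hp => ?_⟩
      have : ((p, 1) : (F × F) × F) = (p, 0) + (0, 1) := by simp
      have h1 := hg hp
      change (f (p, 1)).1 = _
      rw [h1, this, map_add]
      simp

/-- Labelled arrangements of at least three lines with the same betweenness relations are mapped
to each other by a piecewise linear automorphism of the plane. -/
theorem exists_piecewiseLinear_equiv [Finite Λ] [Nontrivial Λ] (h : IsLabelledArrangement P)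
    (h' : IsLabelledArrangement P') (hb : SameBetweenness P P')
    (h3 : ∀ k : Λ, ∃ i j, i ≠ j ∧ i ≠ k ∧ j ≠ k) :
    ∃ f : (F × F) ≃ (F × F), IsPiecewiseLinear f ∧ IsPiecewiseLinear f.symm ∧
      ∀ k p, f p ∈ P' k ↔ p ∈ P k := by
  choose e e' he he' hs using h.exists_forms h' hb h3
  obtain ⟨f, hf, hsnd, hpl, hpl'⟩ := exists_equiv_of_signVectors
    (h.coneForms_pointed he) (h'.coneForms_pointed he')
    (fun x => h.exists_signVector_eq h' hb h3 he he' hs x)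
    (fun x => h'.exists_signVector_eq h hb.symm h3 he' he
      (fun k i j hij => (hs k i j hij).symm) x) none
  have h2 : ∀ x, (f x).2 = x.2 := hsnd
  have h2' : ∀ x, (f.symm x).2 = x.2 := fun x => by rw [← h2, f.apply_symm_apply]
  have hone : ∀ p, f (p, 1) = ((f (p, 1)).1, 1) := fun p => Prod.ext rfl (h2 _)
  have hone' : ∀ p, f.symm (p, 1) = ((f.symm (p, 1)).1, 1) := fun p => Prod.ext rfl (h2' _)
  refine ⟨⟨fun p => (f (p, 1)).1, fun p => (f.symm (p, 1)).1, fun p => ?_, fun p => ?_⟩,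
    isPiecewiseLinear_of_cones hpl, isPiecewiseLinear_of_cones hpl', fun k p => ?_⟩
  · simp only [← hone, f.symm_apply_apply]
  · simp only [← hone', f.apply_symm_apply]
  · have h4 : SignType.sign (homogenize (e' k) (f (p, 1))) =
        SignType.sign (homogenize (e k) (p, 1)) := congrFun (hf (p, 1)) (some k)
    rw [hone, homogenize_one, homogenize_one] at h4
    rw [he, he', ← sign_eq_zero_iff, ← sign_eq_zero_iff (a := e k p), ← h4]
    rfl

end Labelled

/-! ### Construction of the isomorphism -/

section Construction

variable {F : Type*} [Field F] [LinearOrder F] [IsStrictOrderedRing F]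
  {A B : Set (Set (F × F))} {L M : Set (F × F)} {φ : F × F → F × F}

/-- At least three lines: the incidence isomorphism preserves betweenness, which determines the
piecewise linear map. -/
lemma isArrangementIso_of_three_le (hA : IsLineArrangement A) (hB : IsLineArrangement B)
    (hcard : A.ncard = B.ncard) (h3 : 3 ≤ A.ncard) (hφ : IsCollineationIso A B φ)
    (hn : PreservesNookAndCentral A B φ) : IsArrangementIso A B φ := by
  obtain ⟨σ, hσ⟩ := hφ.exists_isIncidenceIso hA hB hcard h3
  have : Finite A := hA.finite.to_subtype
  have hex : ∀ k : A, ∃ i j : A, i ≠ j ∧ i ≠ k ∧ j ≠ k := by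
    rintro ⟨k, hk⟩
    obtain ⟨i, hi, hik⟩ := exists_mem_notMem_finset A {k} (by simp; omega)
    obtain ⟨j, hj, hj'⟩ := exists_mem_notMem_finset A {i, k} (by
      have := Finset.card_le_two (a := i) (b := k); omega)
    simp only [Finset.mem_insert, Finset.mem_singleton, not_or] at hik hj'
    refine ⟨⟨i, hi⟩, ⟨j, hj⟩, ?_, ?_, ?_⟩ <;> simp only [ne_eq, Subtype.mk.injEq]
    exacts [Ne.symm hj'.1, hik, hj'.2]
  have : Nontrivial A := by
    obtain ⟨k, hk, -⟩ := exists_mem_notMem_finset A ∅ (by simp; omega)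
    obtain ⟨i, -, -, hik, -⟩ := hex ⟨k, hk⟩
    exact ⟨i, _, hik⟩
  have hP : IsLabelledArrangement (fun i : A => (i : Set (F × F))) :=
    ⟨by rwa [Subtype.range_coe], Subtype.coe_injective⟩
  have hP' : IsLabelledArrangement (fun i : A => σ i) :=
    ⟨hB.subset (by rintro _ ⟨i, rfl⟩; exact hσ.bijOn_lines.mapsTo i.2),
      fun i j hij => Subtype.ext (hσ.bijOn_lines.injOn i.2 j.2 hij)⟩
  obtain ⟨f, hf, hf', hmem⟩ := exists_piecewiseLinear_equiv hP hP' (fun i j k l h1 h2 h3 h4 h5 h6 =>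
    hσ.isMid_iff hA hB hn i.2 j.2 k.2 l.2 (Subtype.coe_ne_coe.2 h1) (Subtype.coe_ne_coe.2 h2)
      (Subtype.coe_ne_coe.2 h3) (Subtype.coe_ne_coe.2 h4) (Subtype.coe_ne_coe.2 h5)
      (Subtype.coe_ne_coe.2 h6)) hex
  have himg : ∀ L ∈ A, f '' L = σ L := by
    intro L hL
    ext p
    rw [f.image_eq_preimage_symm, mem_preimage, ← hmem ⟨L, hL⟩, f.apply_symm_apply]
  refine ⟨f, hf, hf', ?_, fun p hp => ?_⟩
  · rw [← hσ.bijOn_lines.image_eq]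
    exact image_congr himg
  · obtain ⟨L, hL, M, hM, hLM, hpL, hpM⟩ := hp
    obtain rfl := hA.eq_meet hL hM hLM hpL hpM
    rw [hσ.apply_meet hA hB hL hM hLM]
    exact (hB.eq_meet (hσ.bijOn_lines.mapsTo hL) (hσ.bijOn_lines.mapsTo hM) (hσ.ne hL hM hLM)
      ((hmem ⟨L, hL⟩ _).2 hpL) ((hmem ⟨M, hM⟩ _).2 hpM)).symm

lemma isPiecewiseLinear_affineMap (g : (F × F) →ᵃ[F] (F × F)) : IsPiecewiseLinear g :=
  ⟨{univ}, finite_singleton _, by simp, by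
    rintro _ rfl
    exact ⟨⟨∅, by simp⟩, g, fun _ _ => rfl⟩⟩

lemma isArrangementIso_of_affineEquiv (g : (F × F) ≃ᵃ[F] (F × F))
    (hAB : (fun L => g '' L) '' A = B) (hφ : EqOn φ g (vertices A)) : IsArrangementIso A B φ :=
  ⟨g.toEquiv, isPiecewiseLinear_affineMap g.toAffineMap,
    isPiecewiseLinear_affineMap g.symm.toAffineMap, hAB, hφ⟩

/-- The affine coordinates given by two independent affine functions. -/
lemma exists_affineEquiv_of_det_ne_zero {a b a' b' : F} (c c' : F) (h : a * b' - b * a' ≠ 0) :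
    ∃ T : (F × F) ≃ᵃ[F] (F × F), ∀ p,
      T p = (a * p.1 + b * p.2 - c, a' * p.1 + b' * p.2 - c') := by
  let ℓ : (F × F) →ₗ[F] (F × F) :=
    (a • LinearMap.fst F F F + b • LinearMap.snd F F F).prod
      (a' • LinearMap.fst F F F + b' • LinearMap.snd F F F)
  have hinj : Function.Injective ℓ := by
    rw [← LinearMap.ker_eq_bot, LinearMap.ker_eq_bot']
    rintro ⟨x, y⟩ hxy
    have h1 : a * x + b * y = 0 := congrArg Prod.fst hxy
    have h2 : a' * x + b' * y = 0 := congrArg Prod.snd hxy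
    have hx : (a * b' - b * a') * x = 0 := by linear_combination b' * h1 - b * h2
    have hy : (a * b' - b * a') * y = 0 := by linear_combination a * h2 - a' * h1
    simp only [mul_eq_zero, h, false_or] at hx hy
    rw [hx, hy]; rfl
  refine ⟨(LinearEquiv.ofInjectiveEndo ℓ hinj).toAffineEquiv.trans
    (AffineEquiv.constVAdd F (F × F) (-c, -c')), fun p => ?_⟩
  simp [ℓ, sub_eq_neg_add]

lemma IsLine.exists_affineEquiv (hL : IsLine L) :
    ∃ T : (F × F) ≃ᵃ[F] (F × F), ∀ p, p ∈ L ↔ (T p).1 = 0 := by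
  obtain ⟨a, b, c, hab, rfl⟩ := hL
  obtain ⟨T, hT⟩ := exists_affineEquiv_of_det_ne_zero (a := a) (b := b) (a' := -b) (b' := a) c 0 (by
    intro h
    have : a * a + b * b = 0 := by linear_combination h
    rw [mul_self_add_mul_self_eq_zero] at this
    tauto)
  exact ⟨T, fun p => by simp [hT, sub_eq_zero]⟩

lemma exists_affineEquiv_of_ne (hL : IsLine L) (hM : IsLine M) (hLM : L ≠ M)
    (hne : (L ∩ M).Nonempty) : ∃ T : (F × F) ≃ᵃ[F] (F × F),
      (∀ p, p ∈ L ↔ (T p).1 = 0) ∧ ∀ p, p ∈ M ↔ (T p).2 = 0 := by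
  have hL' := hL
  have hM' := hM
  obtain ⟨a, b, c, hab, rfl⟩ := hL
  obtain ⟨a', b', c', hab', rfl⟩ := hM
  obtain ⟨p, hp, hp'⟩ := hne
  obtain ⟨T, hT⟩ := exists_affineEquiv_of_det_ne_zero (a := a) (b := b) (a' := a') (b' := b') c c'
    (by
      -- otherwise `(-b, a)` is a direction of both lines
      intro h
      refine hLM (hL'.eq_of_mem hM' (p := p) (q := p + (-b, a)) ?_ hp ?_ hp' ?_)
      · intro h0
        have : ((-b, a) : F × F) = 0 := by simpa using h0.symm
        simp at this
        tauto
      · simp only [mem_ofPred_eq, Prod.fst_add, Prod.snd_add] at hp ⊢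
        linear_combination hp
      · simp only [mem_ofPred_eq, Prod.fst_add, Prod.snd_add] at hp' ⊢
        linear_combination hp' + h)
  exact ⟨T, fun p => by simp [hT, sub_eq_zero], fun p => by simp [hT, sub_eq_zero]⟩

lemma vertices_eq_empty (h : A.Subsingleton) : vertices A = ∅ := by
  ext p
  simp only [mem_empty_iff_false, iff_false]
  rintro ⟨L, hL, M, hM, hLM, -⟩
  exact hLM (h hL hM)

/-- At most two lines: an affine map will do. -/
lemma isArrangementIso_of_le_two (hA : IsLineArrangement A) (hB : IsLineArrangement B)
    (hcard : A.ncard = B.ncard) (h2 : A.ncard ≤ 2) (hφ : IsCollineationIso A B φ) :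
    IsArrangementIso A B φ := by
  have himg : ∀ (T T' : (F × F) ≃ᵃ[F] (F × F)) (S S' : Set (F × F)) (π : F × F → F),
      (∀ p, p ∈ S ↔ π (T p) = 0) → (∀ p, p ∈ S' ↔ π (T' p) = 0) →
      (T.trans T'.symm) '' S = S' := by
    intro T T' S S' π hS hS'
    ext p
    constructor
    · rintro ⟨q, hq, rfl⟩
      rw [hS']
      simpa using (hS q).1 hq
    · intro hp
      exact ⟨T.symm (T' p), by rw [hS]; simpa using (hS' p).1 hp, by simp⟩
  obtain h0 | h1 | h2 : A.ncard = 0 ∨ A.ncard = 1 ∨ A.ncard = 2 := by omega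
  · have hA0 := (ncard_eq_zero hA.finite).1 h0
    have hB0 := (ncard_eq_zero hB.finite).1 (hcard ▸ h0)
    subst hA0 hB0
    refine isArrangementIso_of_affineEquiv (AffineEquiv.refl F _) (by simp) ?_
    rw [vertices_eq_empty subsingleton_empty]
    exact eqOn_empty _ _
  · obtain ⟨L, rfl⟩ := ncard_eq_one.1 h1
    obtain ⟨L', rfl⟩ := ncard_eq_one.1 (hcard ▸ h1)
    obtain ⟨T, hT⟩ := (hA.isLine L rfl).exists_affineEquiv
    obtain ⟨T', hT'⟩ := (hB.isLine L' rfl).exists_affineEquiv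
    refine isArrangementIso_of_affineEquiv (T.trans T'.symm) ?_ ?_
    · rw [image_singleton, himg T T' L L' Prod.fst hT hT']
    · rw [vertices_eq_empty subsingleton_singleton]
      exact eqOn_empty _ _
  · obtain ⟨L, M, hLM, rfl⟩ := ncard_eq_two.1 h2
    obtain ⟨L', M', hLM', rfl⟩ := ncard_eq_two.1 (hcard ▸ h2)
    have hL : L ∈ ({L, M} : Set (Set (F × F))) := by simp
    have hM : M ∈ ({L, M} : Set (Set (F × F))) := by simp
    have hL' : L' ∈ ({L', M'} : Set (Set (F × F))) := by simp
    have hM' : M' ∈ ({L', M'} : Set (Set (F × F))) := by simp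
    obtain ⟨T, hT, hT₂⟩ := exists_affineEquiv_of_ne (hA.isLine L hL) (hA.isLine M hM) hLM
      (hA.not_parallel _ hL _ hM hLM)
    obtain ⟨T', hT', hT₂'⟩ := exists_affineEquiv_of_ne (hB.isLine L' hL') (hB.isLine M' hM') hLM'
      (hB.not_parallel _ hL' _ hM' hLM')
    have e1 := himg T T' L L' Prod.fst hT hT'
    have e2 := himg T T' M M' Prod.snd hT₂ hT₂'
    refine isArrangementIso_of_affineEquiv (T.trans T'.symm) ?_ fun p hp => ?_
    · rw [image_pair, e1, e2]
    -- both points are the intersection point of `L'` and `M'`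
    · have hv : ∀ {X Y : Set (F × F)} {q : F × F}, q ∈ vertices {X, Y} → q ∈ X ∧ q ∈ Y := by
        rintro X Y q ⟨S, rfl | rfl, S', rfl | rfl, hne, h, h'⟩
        exacts [absurd rfl hne, ⟨h, h'⟩, ⟨h', h⟩, absurd rfl hne]
      have h1 := hv hp
      have h3 := hv (hφ.bijOn.mapsTo hp)
      exact hB.eq_of_mem hL' hM' hLM' h3.1 h3.2 (e1 ▸ mem_image_of_mem _ h1.1)
        (e2 ▸ mem_image_of_mem _ h1.2)

end Construction

end LineArr

theorem theorem5 {F : Type*} [Field F] [LinearOrder F] [IsStrictOrderedRing F]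
    (A B : Set (Set (F × F)))
    (hA : LineArr.IsLineArrangement A) (hB : LineArr.IsLineArrangement B)
    (hcard : A.ncard = B.ncard) :
    (∀ φ : F × F → F × F, LineArr.IsCollineationIso A B φ →
      LineArr.PreservesNookAndCentral A B φ → LineArr.IsArrangementIso A B φ) ∧
    (∀ φ : F × F → F × F, LineArr.IsArrangementIso A B φ →
      LineArr.IsCollineationIso A B φ ∧ LineArr.PreservesNookAndCentral A B φ) := by
  refine ⟨fun φ hφ hn => ?_, fun φ h => h.isCollineationIso_and_preserves hA hB⟩
  rcases le_or_gt 3 A.ncard with h | h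
  · exact LineArr.isArrangementIso_of_three_le hA hB hcard h hφ hn
  · exact LineArr.isArrangementIso_of_le_two hA hB hcard (by omega) hφ
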